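/- Let $G$ be a locally finite connected (simple, possibly infinite) graph and let $k\in\mathbb N=\{0,1,2,\dots\}$. \textbf{Separations.} A separation of $G$ is a set $\{A,B\}$ with $A\cup B=V(G)$ and no edge of $G$ between $A\setminus B$ and $B\setminus A$; its separator is $A\cap B$, its order is $|A\cap B|$, and its orientations are $(A,B)$ and $(B,A)$. It is proper if $A\setminus B$ and $B\setminus A$ are non-empty. It is tight if there are components $C_A$ and $C_B$ of $G-(A\cap B)$ with $V(C_A)\subseteq A$, $V(C_B)\subseteq B$ and $N_G(C_A)=N_G(C_B)=A\cap B$. Write $(A,B)\ge(C,D)$ if $A\subseteq C$ and $B\supseteq D$. Two separations are nested if they have $\ge$-comparable orientations, and otherwise they cross; a set of separations is nested if its elements are pairwise nested. \textbf{Bottlenecks.} A $\top$-star of $G$ consists of three distinct oriented separations $(A_i,B_i)$, $i\in\{1,2,3\}$, with separators $X_i$, such that the sets $A_i\setminus B_i$ are disjoint with union $V(G)\setminus\bigcup_i X_i$ and every vertex in some $X_i$ lies in at least one other $X_j$. Its constituents are the $\{A_i,B_i\}$, its centre is $Z=X_1\cap X_2\cap X_3$, and $X_{ij}:=(X_i\cap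 X_j)\setminus Z$. It has order $\le k$ if all its elements have order $\le k$. It is relevant with base $\{A_1,B_1\}$ if $\{A_1,B_1\}$ is tight and for every $x\in X_{23}$ and every $i\in\{2,3\}$ there is an edge of $G$ between $x$ and $X_{1i}$, or there are $y\in X_{1i}\cup Z$ and a component $K$ of $G[A_i\setminus B_i]$ with $x,y\in N_G(K)$. A bottleneck of order $k$ is a non-empty set $\beta$ of tight separations of $G$ of order exactly $k$ such that, whenever $\beta$ contains the base of a relevant $\top$-star of $G$ of order $\le k$, at least one of its other two constituents lies in $\beta$ as well. \textbf{The sets $N^{\le k}(G)$.} For $j\in\mathbb N$ let $X^j$ be the union of all bottlenecks of order $j$ in $G$, and let $x^j(s)$ be the number of separations in $X^j$ that $s\in X^j$ crosses. Recursively, put $N^{<j}(G):=\bigcup_{i<j}N^i(G)$; for every bottleneck $\beta$ of order $j$ let $N^j(G,\beta)$ be the set of those $s\in\beta$ that are nested with every element of $N^{<j}(G)$ and among those have minimal $x^j(s)$; and let $N^j(G)$ be the union of all $N^j(G,\beta)$. Finally $N^{\le k}(G):=\bigcup_{j\le k}N^j(G)$. \textbf{The candidate $\mathcal T(N)$.}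 A set $\sigma$ of oriented separations is a star if $(A,B)\ge(D,C)$ for any two distinct $(A,B),(C,D)\in\sigma$. Let $N$ be a nested set of proper separations. A splitting star of $N$ is a star $\sigma$ such that $\{A,B\}\in N$ and $(B,A)\notin\sigma$ for every $(A,B)\in\sigma$, and such that every element of $N$ has an orientation $(C,D)$ with $(C,D)\ge(A,B)$ for some $(A,B)\in\sigma$. Define $\mathcal T(N)=(T,\mathcal V)$ as follows: the nodes of $T$ are the splitting stars of $N$, the edges of $T$ are the elements of $N$, where $\{A,B\}$ joins the nodes containing $(A,B)$ and $(B,A)$, and the part of a node $t$ is the induced subgraph $V_t:=G[\bigcap_{(A,B)\in t}B]$. A tree-decomposition of $G$ is a tree $T$ with a family of induced subgraphs $V_t$ of $G$, one for every node $t$, such that $G=\bigcup_t V_t$ and, for every vertex $v$, the nodes $t$ with $v\in V_t$ induce a connected subgraph of $T$. An edge $t_1t_2$ of $T$ induces the separation $\{A_1,A_2\}$, where $A_i$ is the union of the vertex sets of the parts $V_t$ over all nodes $t$ in the component of $T-t_1t_2$ that contains $t_i$. \textbf{Tangles.} A tangle of order $m$ in $G$, where $m\in\mathbb N\cup\{\infty\}$,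 is a set $\tau$ that contains exactly one orientation of every separation of $G$ of order $<m$, and nothing else, such that $G[A_1]\cup G[A_2]\cup G[A_3]\ne G$ for all (not necessarily distinct) $(A_1,B_1),(A_2,B_2),(A_3,B_3)\in\tau$. A separation distinguishes two tangles (possibly of different orders) if both orient it, and they orient it differently; it does so efficiently if no separation of smaller order distinguishes them. Two tangles are $({\le}\,k)$-distinguishable if some separation of order $\le k$ distinguishes them. \textbf{Theorem.} The construction is well-defined: for every $j\le k$ and $s\in X^j$ the number $x^j(s)$ is finite; $N^{\le k}(G)$ is a nested set of proper separations; every orientation of an element of $N^{\le k}(G)$ lies in exactly one splitting star of $N^{\le k}(G)$, and any two adjacent nodes are joined by exactly one element of $N^{\le k}(G)$. Moreover, $\mathcal T(N^{\le k}(G))$ is a tree-decomposition of $G$, and every two $({\le}\,k)$-distinguishable tangles in $G$ are efficiently distinguished by one of its induced separations. That is, $\mathcal T(N^{\le k}(G))$ is a tree-of-tangles of $G$ of resolution $k$. -/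

import Mathlib

namespace TangleTree

universe u

variable {V : Type u}

/-! ### Separations

An oriented separation `(A, B)` is an element of `Set V × Set V`, an unoriented separation
`{A, B}` is the element `s(A, B)` of `Sym2 (Set V)`. -/

/-- `A ∪ B` is the whole vertex set and there is no edge between `A \ B` and `B \ A`. -/
def IsSep (G : SimpleGraph V) (A B : Set V) : Prop :=
  A ∪ B = Set.univ ∧ ∀ a ∈ A \ B, ∀ b ∈ B \ A, ¬ G.Adj a b

/-- The separator `A ∩ B` of `{A, B}`. -/
def separator : Sym2 (Set V) → Set V :=
  Sym2.lift ⟨fun A B => A ∩ B, fun A B => Set.inter_comm A B⟩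

/-- The order of `{A, B}`: the size of its separator (`⊤` if the separator is infinite). -/
noncomputable def order (s : Sym2 (Set V)) : ℕ∞ := (separator s).encard

/-- `{A, B}` is a separation both of whose sets `A \ B` and `B \ A` are non-empty. -/
def IsProper (G : SimpleGraph V) (s : Sym2 (Set V)) : Prop :=
  ∃ A B, s = s(A, B) ∧ IsSep G A B ∧ (A \ B).Nonempty ∧ (B \ A).Nonempty

/-- `K` is the vertex set of a (connected) component of the induced subgraph `G[S]`. -/
def IsComponent (G : SimpleGraph V) (S K : Set V) : Prop :=
  ∃ c : (G.induce S).ConnectedComponent, K = Subtype.val '' c.supp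

/-- The neighbourhood `N_G(K)`: the vertices outside `K` with a neighbour in `K`. -/
def nbhd (G : SimpleGraph V) (K : Set V) : Set V :=
  {v | v ∉ K ∧ ∃ u ∈ K, G.Adj u v}

/-- `{A, B}` is a tight separation: `G - (A ∩ B)` has components inside `A` and inside `B` whose
neighbourhoods are the whole of `A ∩ B`. -/
def IsTight (G : SimpleGraph V) (s : Sym2 (Set V)) : Prop :=
  ∃ A B, s = s(A, B) ∧ IsSep G A B ∧
    (∃ K, IsComponent G (A ∩ B)ᶜ K ∧ K ⊆ A ∧ nbhd G K = A ∩ B) ∧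
    (∃ K, IsComponent G (A ∩ B)ᶜ K ∧ K ⊆ B ∧ nbhd G K = A ∩ B)

/-- `(A, B) ≥ (C, D)` for oriented separations: `A ⊆ C` and `B ⊇ D`. -/
def SepGE (p q : Set V × Set V) : Prop := p.1 ⊆ q.1 ∧ q.2 ⊆ p.2

/-- Two unoriented separations are nested if they have comparable orientations. -/
def Nested (s t : Sym2 (Set V)) : Prop :=
  ∃ A B C D, s = s(A, B) ∧ t = s(C, D) ∧ (SepGE (A, B) (C, D) ∨ SepGE (C, D) (A, B))

/-- Two unoriented separations cross if they are not nested. -/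
def Crosses (s t : Sym2 (Set V)) : Prop := ¬ Nested s t

/-- A set of separations is nested if its elements are pairwise nested. -/
def IsNestedSet (N : Set (Sym2 (Set V))) : Prop := ∀ s ∈ N, ∀ t ∈ N, Nested s t

/-! ### T-stars and bottlenecks -/

/-- `(A 0, B 0), (A 1, B 1), (A 2, B 2)` are three distinct oriented separations forming a T-star:
the sets `A i \ B i` form a near-partition of the complement of the union of the separators, and
each vertex of a separator lies in at least one of the other two separators. -/
structure IsTStar (G : SimpleGraph V) (A B : Fin 3 → Set V) : Prop where
  sep : ∀ i, IsSep G (A i) (B i)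
  distinct : Function.Injective fun i => (A i, B i)
  disjoint : ∀ i j, i ≠ j → Disjoint (A i \ B i) (A j \ B j)
  union : ⋃ i, (A i \ B i) = (⋃ i, A i ∩ B i)ᶜ
  covered : ∀ i, ∀ x ∈ A i ∩ B i, ∃ j, j ≠ i ∧ x ∈ A j ∩ B j

/-- The centre of a T-star: the intersection of the three separators. -/
def centre (A B : Fin 3 → Set V) : Set V := ⋂ i, A i ∩ B i

/-- The `ij`-link of a T-star. -/
def link (A B : Fin 3 → Set V) (i j : Fin 3) : Set V :=
  ((A i ∩ B i) ∩ (A j ∩ B j)) \ centre A B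

/-- The T-star is relevant with base `{A 0, B 0}`. -/
def IsRelevant (G : SimpleGraph V) (A B : Fin 3 → Set V) : Prop :=
  IsTStar G A B ∧ IsTight G s(A 0, B 0) ∧
    ∀ x ∈ link A B 1 2, ∀ i : Fin 3, i ≠ 0 →
      (∃ y ∈ link A B 0 i, G.Adj x y) ∨
      (∃ y ∈ link A B 0 i ∪ centre A B, ∃ K, IsComponent G (A i \ B i) K ∧
        x ∈ nbhd G K ∧ y ∈ nbhd G K)

/-- `β` is a bottleneck of order `k`: a non-empty set of tight `k`-separations such that, for every
relevant T-star of order at most `k` with base in `β`, another constituent is in `β` as well. -/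
structure IsBottleneck (G : SimpleGraph V) (k : ℕ) (β : Set (Sym2 (Set V))) : Prop where
  nonempty : β.Nonempty
  tight : ∀ s ∈ β, IsTight G s
  order_eq : ∀ s ∈ β, order s = k
  another : ∀ A B : Fin 3 → Set V, IsRelevant G A B → (∀ i, order s(A i, B i) ≤ k) →
    s(A 0, B 0) ∈ β → s(A 1, B 1) ∈ β ∨ s(A 2, B 2) ∈ β

/-! ### Nested separations from bottlenecks -/

/-- The set `X^k` of all separations that lie in some bottleneck of order `k`. -/
def bottleneckSeps (G : SimpleGraph V) (k : ℕ) : Set (Sym2 (Set V)) :=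
  {s | ∃ β, IsBottleneck G k β ∧ s ∈ β}

/-- The elements of `X^k` that are crossed by `s`. -/
def crossedSeps (G : SimpleGraph V) (k : ℕ) (s : Sym2 (Set V)) : Set (Sym2 (Set V)) :=
  {t | t ∈ bottleneckSeps G k ∧ Crosses s t}

/-- The crossing number `x^k(s)`: the number of elements of `X^k` that `s` crosses. -/
noncomputable def crossingNumber (G : SimpleGraph V) (k : ℕ) (s : Sym2 (Set V)) : ℕ∞ :=
  (crossedSeps G k s).encard

/-- The elements of `β` that are nested with all of `M`. -/
def nestedWith (M β : Set (Sym2 (Set V))) : Set (Sym2 (Set V)) :=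
  {s | s ∈ β ∧ ∀ t ∈ M, Nested s t}

/-- The elements of `β` that are nested with all of `M` and, among those, have minimal crossing
number `x^k`. -/
def minimalIn (G : SimpleGraph V) (k : ℕ) (M β : Set (Sym2 (Set V))) : Set (Sym2 (Set V)) :=
  {s | s ∈ nestedWith M β ∧ ∀ t ∈ nestedWith M β, crossingNumber G k s ≤ crossingNumber G k t}

/-- The set `N^{<k}(G)`, by recursion: `N^{<k+1}(G)` consists of `N^{<k}(G)` and of the sets
`N^k(G, β)`, where `β` ranges over the bottlenecks of order `k`. -/
def NBelow (G : SimpleGraph V) : ℕ → Set (Sym2 (Set V))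
  | 0 => ∅
  | k + 1 => NBelow G k ∪ {s | ∃ β, IsBottleneck G k β ∧ s ∈ minimalIn G k (NBelow G k) β}

/-- The set `N^k(G)`, the union of the sets `N^k(G, β)` over all bottlenecks `β` of order `k`. -/
def NLevel (G : SimpleGraph V) (k : ℕ) : Set (Sym2 (Set V)) :=
  {s | ∃ β, IsBottleneck G k β ∧ s ∈ minimalIn G k (NBelow G k) β}

/-- The set `N^{≤k}(G)`. -/
def NUpTo (G : SimpleGraph V) (k : ℕ) : Set (Sym2 (Set V)) := ⋃ j ≤ k, NLevel G j

/-- `N^{<k}(G)` is the union of the `N^j(G)` with `j < k`. -/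
theorem nBelow_eq (G : SimpleGraph V) (k : ℕ) : NBelow G k = ⋃ j < k, NLevel G j := by
  induction k with
  | zero => simp [NBelow]
  | succ k ih =>
    have h : NBelow G (k + 1) = NBelow G k ∪ NLevel G k := rfl
    rw [h, Set.biUnion_lt_succ, ih]

/-! ### Tree-decompositions -/

/-- A star of oriented separations. -/
def IsStar (σ : Set (Set V × Set V)) : Prop :=
  ∀ p ∈ σ, ∀ q ∈ σ, p ≠ q → SepGE p q.swap

/-- A splitting star of a set `N` of separations. -/
structure IsSplittingStar (N : Set (Sym2 (Set V))) (σ : Set (Set V × Set V)) : Prop where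
  star : IsStar σ
  mem : ∀ p ∈ σ, s(p.1, p.2) ∈ N
  swap_notMem : ∀ p ∈ σ, p.swap ∉ σ
  splits : ∀ s ∈ N, ∃ q : Set V × Set V, s = s(q.1, q.2) ∧ ∃ p ∈ σ, SepGE q p

/-- The splitting stars of `N`, which are the nodes of the decomposition tree of `𝒯(N)`. -/
def Node (N : Set (Sym2 (Set V))) : Type u := {σ : Set (Set V × Set V) // IsSplittingStar N σ}

/-- The separation `s = {A, B}` joins the nodes `t₁ ∋ (A, B)` and `t₂ ∋ (B, A)`. -/
def Joins {N : Set (Sym2 (Set V))} (s : Sym2 (Set V)) (t₁ t₂ : Node N) : Prop :=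
  ∃ A B, s = s(A, B) ∧ (A, B) ∈ t₁.1 ∧ (B, A) ∈ t₂.1

/-- The decomposition tree of `𝒯(N)`: two nodes are adjacent if some separation joins them
(which then lies in `N`). -/
def candidateTree (N : Set (Sym2 (Set V))) : SimpleGraph (Node N) where
  Adj t₁ t₂ := ∃ s, Joins s t₁ t₂
  symm := ⟨by
    rintro t₁ t₂ ⟨s, A, B, hs, h₁, h₂⟩
    exact ⟨s, B, A, hs.trans Sym2.eq_swap, h₂, h₁⟩⟩
  loopless := ⟨by
    rintro t ⟨s, A, B, -, h₁, h₂⟩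
    exact t.2.swap_notMem _ h₁ h₂⟩

/-- The part at a node of `𝒯(N)`: the subgraph of `G` induced by the intersection of the sets `B`
over all `(A, B)` in the splitting star. -/
def candidatePart (G : SimpleGraph V) (N : Set (Sym2 (Set V))) (t : Node N) : G.Subgraph :=
  (⊤ : G.Subgraph).induce (⋂ p ∈ t.1, p.2)

/-- The edges of the candidate tree really are the separations in `N`: every orientation of an
element of `N` lies in a unique splitting star, and every edge is given by a unique separation, and
that one is in `N`. -/
def CandidateWellDefined (N : Set (Sym2 (Set V))) : Prop :=
  (∀ A B : Set V, s(A, B) ∈ N → ∃! t : Node N, (A, B) ∈ t.1) ∧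
  (∀ t₁ t₂ : Node N, (candidateTree N).Adj t₁ t₂ → ∃! s, s ∈ N ∧ Joins s t₁ t₂)

/-- `(T, P)` is a tree-decomposition of `G` (with induced subgraphs of `G` as parts). -/
structure IsTreeDecomposition (G : SimpleGraph V) {ι : Type*} (T : SimpleGraph ι)
    (P : ι → G.Subgraph) : Prop where
  tree : T.IsTree
  induced : ∀ t, (P t).IsInduced
  cover : ⨆ t, P t = ⊤
  connected : ∀ v : V, (T.induce {t | v ∈ (P t).verts}).Connected

/-- The side at `t₁` of the separation induced by the edge `t₁t₂` of `T`: the union of the vertex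
sets of the parts over the component of `T - t₁t₂` that contains `t₁`. -/
def inducedSide {G : SimpleGraph V} {ι : Type*} (T : SimpleGraph ι) (P : ι → G.Subgraph)
    (t₁ t₂ : ι) : Set V :=
  {v | ∃ t, (T.deleteEdges {s(t₁, t₂)}).Reachable t₁ t ∧ v ∈ (P t).verts}

/-- The separations induced by `(T, P)`, one for each edge of `T`. -/
def inducedSeps {G : SimpleGraph V} {ι : Type*} (T : SimpleGraph ι) (P : ι → G.Subgraph) :
    Set (Sym2 (Set V)) :=
  {s | ∃ t₁ t₂, T.Adj t₁ t₂ ∧ s = s(inducedSide T P t₁ t₂, inducedSide T P t₂ t₁)}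

/-! ### Tangles -/

/-- `τ` is a tangle of order `m` in `G`, where `m` is a natural number or `⊤`: it is an orientation
of the set of all separations of order less than `m`, and no three of its elements
(not necessarily distinct) have small sides whose induced subgraphs cover `G`. -/
structure IsTangle (G : SimpleGraph V) (m : ℕ∞) (τ : Set (Set V × Set V)) : Prop where
  sep : ∀ p ∈ τ, IsSep G p.1 p.2 ∧ order s(p.1, p.2) < m
  orients : ∀ A B, IsSep G A B → order s(A, B) < m → (A, B) ∈ τ ∨ (B, A) ∈ τ
  not_both : ∀ A B, (A, B) ∈ τ → (B, A) ∈ τ → A = B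
  not_cover : ∀ p ∈ τ, ∀ q ∈ τ, ∀ r ∈ τ,
    (⊤ : G.Subgraph).induce p.1 ⊔ (⊤ : G.Subgraph).induce q.1 ⊔ (⊤ : G.Subgraph).induce r.1 ≠ ⊤

/-- The separation `s` is oriented by both `τ` and `τ'`, and to different sides. -/
def Distinguishes (s : Sym2 (Set V)) (τ τ' : Set (Set V × Set V)) : Prop :=
  ∃ A B, s = s(A, B) ∧ A ≠ B ∧ (A, B) ∈ τ ∧ (B, A) ∈ τ'

/-- `s` distinguishes `τ` and `τ'`, with minimal order. -/
def EfficientlyDistinguishes (s : Sym2 (Set V)) (τ τ' : Set (Set V × Set V)) : Prop :=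
  Distinguishes s τ τ' ∧ ∀ t, Distinguishes t τ τ' → order s ≤ order t

/-- `τ` and `τ'` are `(≤ k)`-distinguishable. -/
def IsDistinguishable (k : ℕ) (τ τ' : Set (Set V × Set V)) : Prop :=
  ∃ s, Distinguishes s τ τ' ∧ order s ≤ k

/-- `(T, P)` is a tree-of-tangles of `G` of resolution `k`. -/
def IsTreeOfTangles (G : SimpleGraph V) {ι : Type*} (T : SimpleGraph ι) (P : ι → G.Subgraph)
    (k : ℕ) : Prop :=
  IsTreeDecomposition G T P ∧
    ∀ (m m' : ℕ∞) (τ τ' : Set (Set V × Set V)), IsTangle G m τ → IsTangle G m' τ' →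
      IsDistinguishable k τ τ' →
        ∃ s ∈ inducedSeps T P, EfficientlyDistinguishes s τ τ'

end TangleTree

/-!
The proof rests on the corners of two crossing tight separations `{A, B}` and `{C, D}`. The two
separators cut each other into four links and a common centre, and each of the four corners, such as
`{A ∩ C, B ∪ D}`, has a separator made up of two adjacent links and the centre. One of the two
separations and its two corners on one side form a T-star, which has order at most that of the
separation if the link between these two corners is a smallest one; tightness makes this T-star
relevant (`isRelevant_of_crosses`). A bottleneck that contains the separation therefore contains
one of the two corners (`IsBottleneck.corner_mem`).

Two separations of equal order chosen from two bottlenecks are nested (`nested_of_mem_minimalIn`):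
if they crossed, the corners obtained from all available T-stars would contradict the choice of
separations with minimal crossing number, because crossing numbers are strictly submodular on
opposite corners (`ncard_crosses_corner_add_lt`). A bottleneck always has an element nested with all
chosen separations of lower order (`nestedWith_NBelow_nonempty`), since an element that crosses one
of these can be replaced by a corner that crosses fewer of them. Both arguments need finiteness:
in a locally finite connected graph a vertex lies in the separators of only finitely many tight
separations of bounded order (`finite_isTight_of_mem_separator`), because such a separator is a
minimal separator of two neighbours of the vertex.

The same finiteness shows that only finitely many elements of `NUpTo G k` separate two given
vertices. For nested sets of proper separations with this property (`IsDiscreteTreeSet`), the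
splitting star containing an orientation `p` consists of `p` and the minimal orientations strictly
above the inverse of `p`. The edge given by `p` splits the decomposition tree into the nodes that
have an element below `p` and those that have one below its inverse. From this it follows that
the tree is acyclic and that its edges induce the elements of `N`; connectedness and the axioms
of a tree-decomposition come from the finiteness of intervals.

Finally, a separation that efficiently distinguishes two tangles is tight, as each tangle lives in a
component of the complement of the separator whose neighbourhood cannot be smaller than the
separator. The first sides of a T-star cover the graph, so a tangle cannot contain all three of its
elements, and if its base is an efficient distinguisher then so is another constituent. Thus the
efficient distinguishers form a bottleneck (`isBottleneck_efficientlyDistinguishes`), and the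
element chosen from it distinguishes the two tangles.
-/

namespace TangleTree

universe u

variable {V : Type u} {G : SimpleGraph V}

/-! ### Components, walks and separations -/

theorem IsComponent.subset {S K : Set V} (h : IsComponent G S K) : K ⊆ S := by
  obtain ⟨c, rfl⟩ := h
  rintro _ ⟨x, -, rfl⟩
  exact x.2

theorem IsComponent.nonempty {S K : Set V} (h : IsComponent G S K) : K.Nonempty := by
  obtain ⟨c, rfl⟩ := h
  exact c.nonempty_supp.image _

theorem IsComponent.mem_of_adj {S K : Set V} (h : IsComponent G S K) {u w : V} (hu : u ∈ K)
    (hw : w ∈ S) (huw : G.Adj u w) : w ∈ K := by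
  obtain ⟨c, rfl⟩ := h
  obtain ⟨x, hx, rfl⟩ := hu
  refine ⟨⟨w, hw⟩, ?_, rfl⟩
  rw [SimpleGraph.ConnectedComponent.mem_supp_iff] at hx ⊢
  rw [← hx]
  refine (SimpleGraph.ConnectedComponent.sound (SimpleGraph.Adj.reachable ?_)).symm
  simpa using huw

/-- Connectedness of a component, as an induction principle. -/
theorem IsComponent.subset_of_closed {S K P : Set V} (h : IsComponent G S K)
    (hne : (K ∩ P).Nonempty) (hP : ∀ u ∈ K, u ∈ P → ∀ w ∈ K, G.Adj u w → w ∈ P) : K ⊆ P := by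
  have hcl := @IsComponent.mem_of_adj V G S K h
  obtain ⟨c, rfl⟩ := h
  obtain ⟨_, ⟨x, hx, rfl⟩, hxP⟩ := hne
  rintro _ ⟨y, hy, rfl⟩
  rw [SimpleGraph.ConnectedComponent.mem_supp_iff] at hx hy
  obtain ⟨p⟩ := SimpleGraph.ConnectedComponent.exact (hx.trans hy.symm)
  clear hy
  induction p with
  | nil => exact hxP
  | @cons a b _ hab _ ih =>
    have hab' : G.Adj a.1 b.1 := by simpa using hab
    have haK : a.1 ∈ Subtype.val '' c.supp := ⟨a, hx, rfl⟩
    have hbK := hcl haK b.2 hab'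
    refine ih ?_ (hP _ haK hxP _ hbK hab')
    obtain ⟨b', hb', hbb⟩ := hbK
    rwa [← Subtype.ext hbb]

theorem exists_isComponent_mem {S : Set V} {u : V} (hu : u ∈ S) :
    ∃ K, IsComponent G S K ∧ u ∈ K :=
  ⟨_, ⟨(G.induce S).connectedComponentMk ⟨u, hu⟩, rfl⟩, ⟨u, hu⟩, rfl, rfl⟩

theorem IsComponent.nbhd_subset {S K : Set V} (h : IsComponent G S K) : nbhd G K ⊆ Sᶜ := by
  rintro v ⟨hv, u, hu, huv⟩ hS
  exact hv (h.mem_of_adj hu hS huv)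

/-- A closed set under adjacency contains the end of every walk that starts in it. -/
theorem mem_of_walk {P : Set V} {u v : V} (p : G.Walk u v)
    (hP : ∀ x ∈ P, ∀ y ∈ p.support, G.Adj x y → y ∈ P) (hu : u ∈ P) : v ∈ P := by
  induction p with
  | nil => exact hu
  | cons h p ih =>
    refine ih (fun x hx y hy hxy => hP x hx y ?_ hxy) (hP _ hu _ ?_ h)
    · simp [hy]
    · simp

theorem IsComponent.exists_walk {S K : Set V} (h : IsComponent G S K) {u v : V} (hu : u ∈ K)
    (hv : v ∈ K) : ∃ p : G.Walk u v, ∀ x ∈ p.support, x ∈ S := by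
  have := h.subset_of_closed (P := {v | ∃ p : G.Walk u v, ∀ x ∈ p.support, x ∈ S})
    ⟨u, hu, .nil, by simpa using h.subset hu⟩ ?_
  · exact this hv
  · rintro a - ⟨p, hp⟩ b hb hab
    refine ⟨p.concat hab, fun x hx => ?_⟩
    rw [SimpleGraph.Walk.support_concat] at hx
    simp only [List.mem_append, List.mem_singleton] at hx
    rcases hx with hx | rfl
    · exact hp x hx
    · exact h.subset hb

/-- In a connected graph a non-empty set of vertices without outgoing edges is everything. -/
theorem eq_univ_of_closed (hG : G.Connected) {P : Set V} (hne : P.Nonempty)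
    (hP : ∀ x ∈ P, ∀ y, G.Adj x y → y ∈ P) : P = Set.univ := by
  obtain ⟨u, hu⟩ := hne
  refine Set.eq_univ_of_forall fun v => ?_
  obtain ⟨p⟩ := hG.preconnected u v
  exact mem_of_walk p (fun x hx y _ => hP x hx y) hu

theorem nbhd_nonempty (hG : G.Connected) {K : Set V} (hK : K.Nonempty) (hK' : K ≠ Set.univ) :
    (nbhd G K).Nonempty := by
  by_contra h
  refine hK' (eq_univ_of_closed hG hK fun x hx y hxy => ?_)
  by_contra hy
  exact h ⟨y, hy, x, hx, hxy⟩

theorem IsSep.symm {A B : Set V} (h : IsSep G A B) : IsSep G B A :=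
  ⟨by rw [Set.union_comm, h.1], fun a ha b hb hab => h.2 b hb a ha hab.symm⟩

theorem IsSep.mem_or {A B : Set V} (h : IsSep G A B) (v : V) : v ∈ A ∨ v ∈ B := by
  have : v ∈ A ∪ B := h.1 ▸ Set.mem_univ v
  exact this

/-- A neighbour of a vertex outside `B` lies in `A`. -/
theorem IsSep.mem_left {A B : Set V} (h : IsSep G A B) {u v : V} (hu : u ∉ B)
    (huv : G.Adj u v) : v ∈ A := by
  by_contra hv
  exact h.2 u ⟨(h.mem_or u).resolve_right hu, hu⟩ v ⟨(h.mem_or v).resolve_left hv, hv⟩ huv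

theorem IsSep.exists_mem_support {A B : Set V} (h : IsSep G A B) {u v : V} (p : G.Walk u v)
    (hu : u ∈ A) (hv : v ∈ B) : ∃ x ∈ p.support, x ∈ A ∩ B := by
  by_contra! hx
  have := mem_of_walk (P := A \ B) p (fun x hx' y hy hxy => ?_)
    ⟨hu, fun hB => hx u (by simp) ⟨hu, hB⟩⟩
  · exact this.2 hv
  · have hyA := h.mem_left hx'.2 hxy
    exact ⟨hyA, fun hB => hx y hy ⟨hyA, hB⟩⟩

@[simp] theorem separator_mk (A B : Set V) : separator s(A, B) = A ∩ B := rfl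

theorem order_mk (A B : Set V) : order s(A, B) = (A ∩ B).encard := rfl

theorem isTight_mk_iff {A B : Set V} : IsTight G s(A, B) ↔ IsSep G A B ∧
    (∃ K, IsComponent G (A ∩ B)ᶜ K ∧ K ⊆ A ∧ nbhd G K = A ∩ B) ∧
    (∃ K, IsComponent G (A ∩ B)ᶜ K ∧ K ⊆ B ∧ nbhd G K = A ∩ B) := by
  constructor
  · rintro ⟨A', B', hs, h, h₁, h₂⟩
    rcases Sym2.eq_iff.1 hs with ⟨rfl, rfl⟩ | ⟨rfl, rfl⟩
    · exact ⟨h, h₁, h₂⟩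
    · rw [Set.inter_comm A B]
      exact ⟨h.symm, h₂, h₁⟩
  · rintro ⟨h, h₁, h₂⟩
    exact ⟨A, B, rfl, h, h₁, h₂⟩

theorem IsTight.sdiff_nonempty {A B : Set V} (h : IsTight G s(A, B)) : (A \ B).Nonempty := by
  obtain ⟨-, ⟨K, hK, hKA, -⟩, -⟩ := isTight_mk_iff.1 h
  obtain ⟨v, hv⟩ := hK.nonempty
  exact ⟨v, hKA hv, fun hB => hK.subset hv ⟨hKA hv, hB⟩⟩

theorem IsTight.swap {A B : Set V} (h : IsTight G s(A, B)) : IsTight G s(B, A) := by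
  rwa [Sym2.eq_swap]

theorem IsTight.isProper {s : Sym2 (Set V)} (h : IsTight G s) : IsProper G s := by
  induction s using Sym2.ind with | _ A B =>
  exact ⟨A, B, rfl, (isTight_mk_iff.1 h).1, h.sdiff_nonempty, h.swap.sdiff_nonempty⟩

theorem IsTight.separator_nonempty (hG : G.Connected) {A B : Set V} (h : IsTight G s(A, B)) :
    (A ∩ B).Nonempty := by
  obtain ⟨-, ⟨K, hK, hKA, hN⟩, -⟩ := isTight_mk_iff.1 h
  rw [← hN]
  refine nbhd_nonempty hG hK.nonempty ?_
  rintro rfl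
  obtain ⟨v, hvB, hvA⟩ := h.swap.sdiff_nonempty
  exact hvA (hKA trivial)

theorem nested_mk_iff {A B C D : Set V} : Nested s(A, B) s(C, D) ↔
    (A ⊆ C ∧ D ⊆ B) ∨ (A ⊆ D ∧ C ⊆ B) ∨ (B ⊆ C ∧ D ⊆ A) ∨ (B ⊆ D ∧ C ⊆ A) := by
  constructor
  · rintro ⟨A', B', C', D', hs, ht, h⟩
    simp only [SepGE] at h
    rcases Sym2.eq_iff.1 hs with ⟨rfl, rfl⟩ | ⟨rfl, rfl⟩ <;>
    rcases Sym2.eq_iff.1 ht with ⟨rfl, rfl⟩ | ⟨rfl, rfl⟩ <;> tauto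
  · rintro (h | h | h | h)
    · exact ⟨A, B, C, D, rfl, rfl, .inl h⟩
    · exact ⟨A, B, D, C, rfl, Sym2.eq_swap, .inl h⟩
    · exact ⟨B, A, C, D, Sym2.eq_swap, rfl, .inl h⟩
    · exact ⟨B, A, D, C, Sym2.eq_swap, Sym2.eq_swap, .inl h⟩

theorem Nested.symm {s t : Sym2 (Set V)} (h : Nested s t) : Nested t s := by
  obtain ⟨A, B, C, D, hs, ht, h⟩ := h
  exact ⟨C, D, A, B, ht, hs, h.symm⟩

/-! ### Finiteness of the number of tight separations -/

/-- `Y` has size at most `n` outside `F ⊆ Y`, and it is the neighbourhood of two distinct components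
of `G - Y`, one containing `u` and the other `v`; in other words, `Y` is an inclusion-minimal
`u`–`v` separator. -/
def minimalSeparators (G : SimpleGraph V) (u v : V) (n : ℕ) (F : Set V) : Set (Set V) :=
  {Y | F ⊆ Y ∧ (Y \ F).encard ≤ n ∧ ∃ K K', IsComponent G Yᶜ K ∧ IsComponent G Yᶜ K' ∧ u ∈ K ∧
    v ∈ K' ∧ v ∉ K ∧ nbhd G K = Y ∧ nbhd G K' = Y}

/-- If `F` separates `u` from `v`, then no other minimal separator contains `F`; otherwise every
separator containing `F` also meets a fixed path in `G - F`, and one of the finitely many vertices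
of that path can be added to `F`. -/
theorem finite_minimalSeparators (u v : V) (n : ℕ) (F : Set V) :
    (minimalSeparators G u v n F).Finite := by
  induction n generalizing F with
  | zero =>
    refine (Set.finite_singleton F).subset ?_
    rintro Y ⟨hF, hn, -⟩
    have h0 : Y \ F = ∅ := by simpa using hn
    exact subset_antisymm (Set.sdiff_eq_empty.1 h0) hF
  | succ n ih =>
    by_cases hu : u ∈ F
    · refine Set.Finite.subset Set.finite_empty ?_
      rintro Y ⟨hF, -, K, K', hK, -, huK, -⟩
      exact (hK.subset huK (hF hu)).elim
    obtain ⟨L, hL, huL⟩ := exists_isComponent_mem (G := G) (S := Fᶜ) hu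
    have key : ∀ Y, F ⊆ Y → ∀ K, IsComponent G Yᶜ K → (K ∩ L).Nonempty → K ⊆ L := by
      intro Y hF K hK hne
      refine hK.subset_of_closed hne fun a _ ha b hb hab => ?_
      exact hL.mem_of_adj ha (fun hbF => hK.subset hb (hF hbF)) hab
    by_cases hv : v ∈ L
    · obtain ⟨p, hp⟩ := hL.exists_walk huL hv
      refine ((p.support.finite_toSet).biUnion fun x _ => ih (insert x F)).subset ?_
      rintro Y ⟨hF, hn, K, K', hK, hK', huK, hvK', hvK, hN, hN'⟩
      have : ∃ x ∈ p.support, x ∈ Y := by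
        by_contra! h
        exact hvK (mem_of_walk p (fun a ha b hb hab => hK.mem_of_adj ha (h b hb) hab) huK)
      obtain ⟨x, hx, hxY⟩ := this
      simp only [Set.mem_iUnion]
      refine ⟨x, hx, Set.insert_subset hxY hF, ?_, K, K', hK, hK', huK, hvK', hvK, hN, hN'⟩
      have hxF : x ∈ Y \ F := ⟨hxY, hp x hx⟩
      have h1 : Y \ insert x F = (Y \ F) \ {x} := by
        ext y; simp only [Set.mem_sdiff, Set.mem_insert_iff, Set.mem_singleton_iff]; tauto
      rw [h1]
      have h2 := Set.encard_sdiff_singleton_add_one hxF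
      rw [← h2] at hn
      push_cast at hn
      exact (ENat.add_le_add_iff_right (by simp)).1 hn
    · refine (Set.finite_singleton F).subset ?_
      rintro Y ⟨hF, hn, K, K', hK, hK', huK, hvK', hvK, hN, hN'⟩
      refine subset_antisymm (fun y hy => ?_) hF
      by_contra hyF
      obtain ⟨-, w, hw, hwy⟩ := (hN ▸ hy : y ∈ nbhd G K)
      obtain ⟨-, w', hw', hwy'⟩ := (hN' ▸ hy : y ∈ nbhd G K')
      have hyL : y ∈ L := hL.mem_of_adj (key Y hF K hK ⟨u, huK, huL⟩ hw) hyF hwy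
      have hw'L : w' ∈ L :=
        hL.mem_of_adj hyL (fun h => hK'.subset hw' (hF h)) hwy'.symm
      exact hv (key Y hF K' hK' ⟨w', hw', hw'L⟩ hvK')

/-- Each component of `G - Y` has a vertex in `N(Y)`, so a separation with separator `Y` is
determined by the trace of one of its sides on this finite set. -/
theorem finite_isSep_of_inter_eq (hfin : ∀ v, (G.neighborSet v).Finite) (hG : G.Connected)
    {Y : Set V} (hY : Y.Finite) (hne : Y.Nonempty) :
    {p : Set V × Set V | IsSep G p.1 p.2 ∧ p.1 ∩ p.2 = Y}.Finite := by
  set W : Set V := ⋃ y ∈ Y, G.neighborSet y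
  have hW : W.Finite := hY.biUnion fun y _ => hfin y
  refine Set.Finite.of_finite_image (f := fun p => p.1 ∩ W)
    (hW.finite_subsets.subset ?_) ?_
  · rintro _ ⟨p, -, rfl⟩
    exact Set.inter_subset_right
  · have key : ∀ A B A' B' : Set V, IsSep G A B → IsSep G A' B' → A ∩ B = Y → A' ∩ B' = Y →
        A ∩ W = A' ∩ W → A ⊆ A' := by
      intro A B A' B' h h' hY₁ hY₂ hAW v hv
      by_contra hv'
      have hvY : v ∉ Y := fun hy => hv' (hY₂ ▸ hy : v ∈ A' ∩ B').1
      have hvB : v ∉ B := fun hB => hvY (hY₁ ▸ ⟨hv, hB⟩)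
      obtain ⟨K, hK, hvK⟩ := exists_isComponent_mem (G := G) (S := Yᶜ) hvY
      have hKP : K ⊆ A \ A' := by
        refine hK.subset_of_closed ⟨v, hvK, hv, hv'⟩ fun a ha haP b hb hab => ?_
        have haB : a ∉ B := fun hB => hK.subset ha (hY₁ ▸ ⟨haP.1, hB⟩)
        refine ⟨h.mem_left haB hab, fun hbA' => ?_⟩
        exact hK.subset hb (hY₂ ▸ ⟨hbA', h'.symm.mem_left haP.2 hab⟩)
      obtain ⟨z, hz⟩ := nbhd_nonempty hG hK.nonempty (by
        rintro rfl
        obtain ⟨y, hy⟩ := hne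
        exact hK.subset trivial hy)
      have hzY : z ∈ Y := by simpa using hK.nbhd_subset hz
      obtain ⟨-, w, hw, hwz⟩ := hz
      have hwW : w ∈ W := Set.mem_biUnion hzY hwz.symm
      exact (hKP hw).2 (hAW ▸ ⟨(hKP hw).1, hwW⟩ : w ∈ A' ∩ W).1
    have keyB : ∀ A B : Set V, IsSep G A B → A ∩ B = Y → B = Aᶜ ∪ Y := by
      rintro A B h rfl
      ext x
      have := h.mem_or x
      simp only [Set.mem_union, Set.mem_compl_iff, Set.mem_inter_iff]
      tauto
    rintro ⟨A, B⟩ ⟨h, hAB⟩ ⟨A', B'⟩ ⟨h', hAB'⟩ hAW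
    have hA : A = A' := subset_antisymm (key A B A' B' h h' hAB hAB' hAW)
      (key A' B' A B h' h hAB' hAB hAW.symm)
    subst hA
    rw [Prod.mk.injEq]
    exact ⟨rfl, (keyB A B h hAB).trans (keyB A B' h' hAB').symm⟩

/-- A vertex lies in the separators of only finitely many tight separations of bounded order: any
two full components contain neighbours of the vertex, and the separator is a minimal separator
of two such neighbours. -/
theorem finite_isTight_of_mem_separator (hfin : ∀ v, (G.neighborSet v).Finite)
    (hG : G.Connected) (n : ℕ) (x : V) :
    {s | IsTight G s ∧ order s ≤ n ∧ x ∈ separator s}.Finite := by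
  have h : (⋃ u ∈ G.neighborSet x, ⋃ v ∈ G.neighborSet x,
      ⋃ Y ∈ {Y ∈ minimalSeparators G u v n ∅ | Y.Finite ∧ Y.Nonempty},
      (fun p : Set V × Set V => s(p.1, p.2)) ''
        {p : Set V × Set V | IsSep G p.1 p.2 ∧ p.1 ∩ p.2 = Y}).Finite := by
    refine (hfin x).biUnion fun u _ => (hfin x).biUnion fun v _ => ?_
    refine ((finite_minimalSeparators u v n ∅).subset (Set.sep_subset _ _)).biUnion ?_
    rintro Y ⟨-, hY, hne⟩
    exact (finite_isSep_of_inter_eq hfin hG hY hne).image _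
  refine h.subset ?_
  rintro s ⟨hs, hn, hx⟩
  induction s using Sym2.ind with | _ A B =>
  obtain ⟨hsep, ⟨K, hK, hKA, hN⟩, ⟨K', hK', hKB, hN'⟩⟩ := isTight_mk_iff.1 hs
  rw [separator_mk] at hx
  obtain ⟨-, u, hu, hux⟩ := (hN ▸ hx : x ∈ nbhd G K)
  obtain ⟨-, v, hv, hvx⟩ := (hN' ▸ hx : x ∈ nbhd G K')
  simp only [Set.mem_iUnion]
  refine ⟨u, hux.symm, v, hvx.symm, A ∩ B, ⟨⟨Set.empty_subset _, ?_, K, K', hK, hK', hu, hv, ?_, hN,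
    hN'⟩, ?_, ⟨x, hx⟩⟩, ⟨(A, B), ⟨hsep, rfl⟩, rfl⟩⟩
  · simpa [order_mk] using hn
  · exact fun hvK => hK'.subset hv ⟨hKA hvK, hKB hv⟩
  · exact Set.finite_of_encard_le_coe hn

/-- If `A ∩ B` lies strictly on the side `C` of a tight separation `{C, D}`, then `D` avoids `B` or
`A`: a full component in `D` lies strictly on one side of `{A, B}`, so it takes `C ∩ D` with it, and
nothing of `D` on the other side of `{A, B}` could be attached to the rest of the graph. -/
theorem IsTight.nested_of_separator_subset (hG : G.Connected) {A B C D : Set V}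
    (h : IsSep G A B) (ht : IsTight G s(C, D)) (hX : A ∩ B ⊆ C \ D) :
    Nested s(A, B) s(C, D) := by
  obtain ⟨hCD, -, ⟨K, hK, hKD, hN⟩⟩ := isTight_mk_iff.1 ht
  have hKX : ∀ v ∈ K, v ∉ A ∩ B := fun v hv hvX => (hX hvX).2 (hKD hv)
  have main : ∀ A B : Set V, IsSep G A B → A ∩ B ⊆ C \ D → (∀ v ∈ K, v ∉ A ∩ B) →
      (∃ u ∈ K, u ∈ A) → Nested s(A, B) s(C, D) := by
    rintro A B h hX hKX ⟨u, hu, huA⟩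
    have hKA : K ⊆ A := by
      refine hK.subset_of_closed ⟨u, hu, huA⟩ fun a ha haA b _ hab => ?_
      exact h.mem_left (fun haB => hKX a ha ⟨haA, haB⟩) hab
    have hYB : ∀ y ∈ C ∩ D, y ∉ B := by
      intro y hy hyB
      obtain ⟨-, w, hw, hwy⟩ := (hN ▸ hy : y ∈ nbhd G K)
      have hyA : y ∈ A := h.mem_left (fun hwB => hKX w hw ⟨hKA hw, hwB⟩) hwy
      exact (hX ⟨hyA, hyB⟩).2 hy.2
    have hDB : ∀ v ∈ D, v ∉ B := by
      intro v hvD hvB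
      have hP := eq_univ_of_closed hG (P := D ∩ B) ⟨v, hvD, hvB⟩ (by
        rintro a ⟨haD, haB⟩ b hab
        have haC : a ∉ C := fun haC => hYB a ⟨haC, haD⟩ haB
        have haA : a ∉ A := fun haA => (hX ⟨haA, haB⟩).2 haD
        exact ⟨hCD.symm.mem_left haC hab, h.symm.mem_left haA hab⟩)
      have huB : u ∈ D ∩ B := hP ▸ Set.mem_univ u
      exact hKX u hu ⟨huA, huB.2⟩
    exact nested_mk_iff.2 (.inr (.inr (.inl ⟨fun v hv => (hCD.mem_or v).resolve_right
      fun hD => hDB v hD hv, fun v hv => (h.mem_or v).resolve_right (hDB v hv)⟩)))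
  obtain ⟨u, hu⟩ := hK.nonempty
  rcases h.mem_or u with huA | huB
  · exact main A B h hX hKX ⟨u, hu, huA⟩
  · rw [Sym2.eq_swap]
    rw [Set.inter_comm] at hX hKX
    exact main B A h.symm hX hKX ⟨u, hu, huB⟩

/-- A tight separation crossing `{A, B}` has to meet any connected set that contains `A ∩ B`, for
instance a finite union of paths. -/
theorem finite_isTight_crosses (hfin : ∀ v, (G.neighborSet v).Finite) (hG : G.Connected) (n : ℕ)
    {s : Sym2 (Set V)} (hs : IsTight G s) (hfs : order s ≠ ⊤) :
    {t | IsTight G t ∧ order t ≤ n ∧ Crosses s t}.Finite := by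
  induction s using Sym2.ind with | _ A B =>
  have hX : (A ∩ B).Finite := Set.encard_ne_top_iff.1 hfs
  obtain ⟨x₀, hx₀⟩ := hs.separator_nonempty hG
  refine Set.Finite.subset (s := ⋃ x ∈ A ∩ B, ⋃ y ∈ {y | y ∈ (hG.preconnected x₀ x).some.support},
    {s | IsTight G s ∧ order s ≤ n ∧ y ∈ separator s}) (hX.biUnion fun x _ =>
    (List.finite_toSet _).biUnion fun y _ => finite_isTight_of_mem_separator hfin hG n y) ?_
  rintro t ⟨ht, hn, hcr⟩
  induction t using Sym2.ind with | _ C D =>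
  by_contra hmem
  simp only [Set.mem_iUnion, not_exists] at hmem
  have hav : ∀ x ∈ A ∩ B, ∀ y ∈ (hG.preconnected x₀ x).some.support, y ∉ C ∩ D :=
    fun x hx y hy hyY => hmem x hx y hy ⟨ht, hn, hyY⟩
  have hCD := (isTight_mk_iff.1 ht).1
  have hAB := (isTight_mk_iff.1 hs).1
  have main : ∀ C D : Set V, IsTight G s(C, D) → x₀ ∈ C →
      (∀ x ∈ A ∩ B, ∀ y ∈ (hG.preconnected x₀ x).some.support, y ∉ C ∩ D) →
      Nested s(A, B) s(C, D) := by
    intro C D ht hx₀C hav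
    have hCD := (isTight_mk_iff.1 ht).1
    refine ht.nested_of_separator_subset hG hAB fun x hx => ?_
    have hxD : x ∉ D := by
      intro hxD
      obtain ⟨y, hy, hyY⟩ := hCD.exists_mem_support (hG.preconnected x₀ x).some hx₀C hxD
      exact hav x hx y hy hyY
    exact ⟨(hCD.mem_or x).resolve_right hxD, hxD⟩
  rcases hCD.mem_or x₀ with hC | hD
  · exact hcr (main C D ht hC hav)
  · rw [Sym2.eq_swap (a := C)] at hcr
    rw [Set.inter_comm C D] at hav
    exact hcr (main D C ht.swap hD hav)

/-! ### Corners of crossing separations -/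

/-- The corner of the separations `{A, B}` and `{C, D}` at the sides `A` and `C`: the separation
`{A ∩ C, B ∪ D}`. -/
def corner (A B C D : Set V) : Sym2 (Set V) := s(A ∩ C, B ∪ D)

theorem corner_comm (A B C D : Set V) : corner A B C D = corner C D A B := by
  rw [corner, corner, Set.inter_comm, Set.union_comm]

theorem nested_corner_self (A B C D : Set V) : Nested s(A, B) (corner A B C D) :=
  nested_mk_iff.2 (.inr (.inr (.inr ⟨Set.subset_union_left, Set.inter_subset_left⟩)))

/-- What is nested with both of two crossing separations is nested with their corners. -/
theorem Nested.corner {r : Sym2 (Set V)} {A B C D : Set V} (hs : Nested r s(A, B))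
    (ht : Nested r s(C, D)) (hcr : Crosses s(A, B) s(C, D)) : Nested r (corner A B C D) := by
  induction r using Sym2.ind with | _ P Q =>
  rw [Crosses, nested_mk_iff] at hcr
  rw [TangleTree.corner]
  rw [nested_mk_iff] at *
  simp only [not_or, not_and] at hcr
  obtain ⟨h1, h2, h3, h4⟩ := hcr
  rcases hs with ⟨a, b⟩ | ⟨a, b⟩ | ⟨a, b⟩ | ⟨a, b⟩ <;>
  rcases ht with ⟨c, d⟩ | ⟨c, d⟩ | ⟨c, d⟩ | ⟨c, d⟩ <;>
  first
  | exact .inl ⟨Set.subset_inter a c, Set.union_subset b d⟩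
  | exact .inr (.inr (.inl ⟨Set.subset_inter a c, Set.union_subset b d⟩))
  | exact .inr (.inl ⟨a.trans Set.subset_union_left, Set.inter_subset_left.trans b⟩)
  | exact .inr (.inl ⟨c.trans Set.subset_union_right, Set.inter_subset_right.trans d⟩)
  | exact .inr (.inr (.inr ⟨a.trans Set.subset_union_left, Set.inter_subset_left.trans b⟩))
  | exact .inr (.inr (.inr ⟨c.trans Set.subset_union_right, Set.inter_subset_right.trans d⟩))
  | exact absurd (d.trans a) (h3 (b.trans c))

/-- What is nested with one of two separations is nested with one of two opposite corners. -/
theorem Nested.corner_or {r : Sym2 (Set V)} {A B : Set V} (C D : Set V)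
    (hs : Nested r s(A, B)) :
    Nested r (TangleTree.corner A B C D) ∨ Nested r (TangleTree.corner B A D C) := by
  induction r using Sym2.ind with | _ P Q =>
  simp only [TangleTree.corner]
  rw [nested_mk_iff] at hs
  rcases hs with ⟨a, b⟩ | ⟨a, b⟩ | ⟨a, b⟩ | ⟨a, b⟩
  · exact .inr (nested_mk_iff.2 (.inr (.inl
      ⟨a.trans Set.subset_union_left, Set.inter_subset_left.trans b⟩)))
  · exact .inl (nested_mk_iff.2 (.inr (.inl
      ⟨a.trans Set.subset_union_left, Set.inter_subset_left.trans b⟩)))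
  · exact .inr (nested_mk_iff.2 (.inr (.inr (.inr
      ⟨a.trans Set.subset_union_left, Set.inter_subset_left.trans b⟩))))
  · exact .inl (nested_mk_iff.2 (.inr (.inr (.inr
      ⟨a.trans Set.subset_union_left, Set.inter_subset_left.trans b⟩))))

theorem Crosses.symm {s t : Sym2 (Set V)} (h : Crosses s t) : Crosses t s :=
  fun h' => h h'.symm

theorem Crosses.swap_left {A B C D : Set V} (h : Crosses s(A, B) s(C, D)) :
    Crosses s(B, A) s(C, D) := by
  rwa [Sym2.eq_swap]

theorem Crosses.swap_right {A B C D : Set V} (h : Crosses s(A, B) s(C, D)) :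
    Crosses s(A, B) s(D, C) := by
  rwa [Sym2.eq_swap (a := D)]

theorem IsSep.corner {A B C D : Set V} (h : IsSep G A B) (h' : IsSep G C D) :
    IsSep G (A ∩ C) (B ∪ D) := by
  refine ⟨Set.eq_univ_of_forall fun v => ?_, ?_⟩
  · have := h.mem_or v
    have := h'.mem_or v
    simp only [Set.mem_union, Set.mem_inter_iff]
    tauto
  · rintro a ⟨⟨haA, haC⟩, ha⟩ b ⟨-, hb⟩ hab
    simp only [Set.mem_union, not_or] at ha
    exact hb ⟨h.mem_left ha.1 hab, h'.mem_left ha.2 hab⟩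

/-- The separator of a corner consists of two links and the centre. -/
theorem order_corner {A B C D : Set V} (hAB : A ∪ B = Set.univ) (hCD : C ∪ D = Set.univ)
    (hX : (A ∩ B).Finite) (hY : (C ∩ D).Finite) :
    order (TangleTree.corner A B C D) = (((A ∩ B) \ D).ncard + ((C ∩ D) \ B).ncard +
      (A ∩ B ∩ (C ∩ D)).ncard : ℕ) := by
  have hZ : (A ∩ B ∩ (C ∩ D)).Finite := hX.subset Set.inter_subset_left
  have h1 : (A ∩ C) ∩ (B ∪ D) =
      ((A ∩ B) \ D ∪ (C ∩ D) \ B) ∪ (A ∩ B ∩ (C ∩ D)) := by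
    ext x
    have h1 : x ∈ A ∪ B := hAB ▸ trivial
    have h2 : x ∈ C ∪ D := hCD ▸ trivial
    simp only [Set.mem_union, Set.mem_inter_iff, Set.mem_sdiff] at *
    tauto
  have hX' := hX.subset (Set.sdiff_subset (t := D))
  have hY' := hY.subset (Set.sdiff_subset (t := B))
  rw [TangleTree.corner, order_mk, h1, ← ((hX'.union hY').union hZ).cast_ncard_eq,
    Set.ncard_union_eq _ (hX'.union hY') hZ, Set.ncard_union_eq _ hX' hY']
  · exact Set.disjoint_left.2 fun x hx hx' => hx.2 hx'.1.2
  · refine Set.disjoint_left.2 fun x hx hx' => ?_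
    rcases hx with hx | hx
    · exact hx.2 hx'.2.2
    · exact hx.2 hx'.1.2

theorem ncard_separator {A B C D : Set V} (hCD : C ∪ D = Set.univ) (hX : (A ∩ B).Finite) :
    (A ∩ B).ncard = ((A ∩ B) \ D).ncard + ((A ∩ B) \ C).ncard +
      (A ∩ B ∩ (C ∩ D)).ncard := by
  have h1 : (A ∩ B) = ((A ∩ B) \ D ∪ (A ∩ B) \ C) ∪ (A ∩ B ∩ (C ∩ D)) := by
    ext x
    have h2 : x ∈ C ∪ D := hCD ▸ trivial
    simp only [Set.mem_union, Set.mem_inter_iff, Set.mem_sdiff] at *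
    tauto
  have hD := hX.subset (Set.sdiff_subset (t := D))
  have hC := hX.subset (Set.sdiff_subset (t := C))
  have hZ : (A ∩ B ∩ (C ∩ D)).Finite := hX.subset Set.inter_subset_left
  conv_lhs => rw [h1]
  rw [Set.ncard_union_eq _ (hD.union hC) hZ, Set.ncard_union_eq _ hD hC]
  · refine Set.disjoint_left.2 fun x hx hx' => ?_
    have h2 : x ∈ C ∪ D := hCD ▸ trivial
    rcases h2 with h | h
    · exact hx'.2 h
    · exact hx.2 h
  · refine Set.disjoint_left.2 fun x hx hx' => ?_
    rcases hx with hx | hx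
    · exact hx.2 hx'.2.2
    · exact hx.2 hx'.2.1

/-! ### The T-stars of two crossing tight separations -/

/-- The condition in the definition of relevance holds automatically as soon as the separator of
`{C, D}` is not contained in `B \ A`: a full component in `C` of the complement of that separator
contains a path from a given vertex of the separator in `B \ A` to a vertex in `A`, and this path
first leaves `B \ A` in the separator of `{A, B}`. -/
theorem exists_adj_or_component {A B C D : Set V} (hAB : IsSep G A B) (hCD : IsSep G C D)
    (hK : ∃ K, IsComponent G (C ∩ D)ᶜ K ∧ K ⊆ C ∧ nbhd G K = C ∩ D)
    (hne : ((C ∩ D) \ B).Nonempty) {x : V} (hx : x ∈ (C ∩ D) \ A) :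
    (∃ y ∈ (A ∩ B) \ D, G.Adj x y) ∨
    (∃ y ∈ A ∩ B ∩ C, ∃ K, IsComponent G ((B ∩ C) \ (A ∪ D)) K ∧ x ∈ nbhd G K ∧ y ∈ nbhd G K) := by
  obtain ⟨L, hL, hLC, hN⟩ := hK
  have hLD : ∀ v ∈ L, v ∉ D := fun v hv hD => hL.subset hv ⟨hLC hv, hD⟩
  obtain ⟨-, u, hu, hux⟩ := (hN ▸ hx.1 : x ∈ nbhd G L)
  have huB : u ∈ B := hAB.symm.mem_left hx.2 hux.symm
  by_cases huA : u ∈ A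
  · exact .inl ⟨u, ⟨⟨huA, huB⟩, hLD u hu⟩, hux.symm⟩
  right
  have huS : u ∈ (B ∩ C) \ (A ∪ D) := ⟨⟨huB, hLC hu⟩, fun h => h.elim huA (hLD u hu)⟩
  obtain ⟨K, hK, huK⟩ := exists_isComponent_mem (G := G) huS
  have hxK : x ∈ nbhd G K := ⟨fun h => (hK.subset h).2 (.inr hx.1.2), u, huK, hux⟩
  by_contra! hno
  have hstep : ∀ v ∈ K, ∀ w, G.Adj v w → w ∉ K → w ∈ C ∩ D ∧ w ∈ B := by
    intro v hv w hvw hw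
    have hvS := hK.subset hv
    have hwB : w ∈ B := hAB.symm.mem_left (fun h => hvS.2 (.inl h)) hvw
    have hwC : w ∈ C := hCD.mem_left (fun h => hvS.2 (.inr h)) hvw
    have hwA : w ∉ A := fun hwA =>
      hno w ⟨⟨hwA, hwB⟩, hwC⟩ K hK hxK ⟨hw, v, hv, hvw⟩
    refine ⟨⟨hwC, ?_⟩, hwB⟩
    by_contra hwD
    exact hw (hK.mem_of_adj hv ⟨⟨hwB, hwC⟩, fun h => h.elim hwA hwD⟩ hvw)
  have hLK : L ⊆ K := by
    refine hL.subset_of_closed ⟨u, hu, huK⟩ fun a _ haK b hb hab => ?_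
    by_contra hbK
    exact hL.subset hb (hstep a haK b hab hbK).1
  obtain ⟨y, hy, hyB⟩ := hne
  obtain ⟨-, w, hw, hwy⟩ := (hN ▸ hy : y ∈ nbhd G L)
  refine hyB (hstep w (hLK hw) y hwy fun hyK => ?_).2
  exact (hK.subset hyK).2 (.inr hy.2)

/-- A separation `{A, B}` and its two corners on the side of `B` form a T-star. -/
theorem isTStar_of_crosses {A B C D : Set V} (hAB : IsSep G A B) (hCD : IsSep G C D)
    (hcr : Crosses s(A, B) s(C, D)) (hne : B ∩ C ≠ B ∩ D) :
    IsTStar G ![A, B ∩ C, B ∩ D] ![B, A ∪ D, A ∪ C] := by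
  rw [Crosses, nested_mk_iff] at hcr
  have hCX := hAB.mem_or
  have hCY := hCD.mem_or
  refine ⟨?_, ?_, ?_, ?_, ?_⟩
  · intro i
    fin_cases i
    · exact hAB
    · exact hAB.symm.corner hCD
    · exact hAB.symm.corner hCD.symm
  · have h1 : ¬ (A = B ∩ C ∧ B = A ∪ D) := by
      rintro ⟨h1, h2⟩
      exact hcr (.inl ⟨h1.subset.trans Set.inter_subset_right,
        Set.subset_union_right.trans h2.symm.subset⟩)
    have h2 : ¬ (A = B ∩ D ∧ B = A ∪ C) := by
      rintro ⟨h1, h2⟩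
      exact hcr (.inr (.inl ⟨h1.subset.trans Set.inter_subset_right,
        Set.subset_union_right.trans h2.symm.subset⟩))
    intro i j hij
    simp only [Prod.mk.injEq] at hij
    fin_cases i <;> fin_cases j
    all_goals first
      | rfl
      | exact absurd hij h1
      | exact absurd hij h2
      | exact absurd hij.1 hne
      | exact (h1 ⟨hij.1.symm, hij.2.symm⟩).elim
      | exact (h2 ⟨hij.1.symm, hij.2.symm⟩).elim
      | exact absurd hij.1.symm hne
  · have h₀ : ∀ E F : Set V, Disjoint (A \ B) ((B ∩ E) \ (A ∪ F)) := fun E F =>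
      Set.disjoint_left.2 fun v hv hv' => hv.2 hv'.1.1
    have h₁ : Disjoint ((B ∩ C) \ (A ∪ D)) ((B ∩ D) \ (A ∪ C)) :=
      Set.disjoint_left.2 fun v hv hv' => hv.2 (.inr hv'.1.2)
    intro i j hij
    fin_cases i <;> fin_cases j
    all_goals first
      | exact absurd rfl hij
      | exact h₀ _ _
      | exact (h₀ _ _).symm
      | exact h₁
      | exact h₁.symm
  · ext v
    have h₀ := hCX v
    have h₁ := hCY v
    simp only [Set.mem_iUnion, Fin.exists_fin_succ, Set.mem_compl_iff]
    simp only [Matrix.cons_val_zero, Matrix.cons_val_succ, IsEmpty.exists_iff, or_false,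
      Set.mem_sdiff, Set.mem_inter_iff, Set.mem_union]
    clear hCX hCY hcr hne
    tauto
  · have h₀ : ∀ v ∈ A ∩ B, v ∈ B ∩ C ∩ (A ∪ D) ∨ v ∈ B ∩ D ∩ (A ∪ C) := fun v hv =>
      (hCY v).imp (fun h => ⟨⟨hv.2, h⟩, .inl hv.1⟩) (fun h => ⟨⟨hv.2, h⟩, .inl hv.1⟩)
    have h₁ : ∀ E F, ∀ v ∈ B ∩ E ∩ (A ∪ F), v ∈ A ∩ B ∨ v ∈ B ∩ F ∩ (A ∪ E) := fun E F v hv =>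
      hv.2.imp (fun h => ⟨h, hv.1.1⟩) (fun h => ⟨⟨hv.1.1, h⟩, .inr hv.1.2⟩)
    intro i v hv
    fin_cases i
    · rcases h₀ v hv with h | h
      · exact ⟨1, by simp, h⟩
      · exact ⟨2, by simp, h⟩
    · rcases h₁ C D v hv with h | h
      · exact ⟨0, by simp, h⟩
      · exact ⟨2, by simp, h⟩
    · rcases h₁ D C v hv with h | h
      · exact ⟨0, by simp, h⟩
      · exact ⟨1, by simp, h⟩

/-- If the part of the separator of `{C, D}` in `B \ A` is a smallest one among the four links of
two crossing tight separations `{A, B}` and `{C, D}`, then `{A, B}` and its two corners on the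
side of `B` form a relevant T-star. -/
theorem isRelevant_of_crosses {A B C D : Set V} (hs : IsTight G s(A, B)) (ht : IsTight G s(C, D))
    (hcr : Crosses s(A, B) s(C, D)) (hY : (C ∩ D).Finite)
    (ha : ((C ∩ D) \ A).ncard ≤ ((C ∩ D) \ B).ncard)
    (hc : ((C ∩ D) \ A).ncard ≤ ((A ∩ B) \ D).ncard) :
    IsRelevant G ![A, B ∩ C, B ∩ D] ![B, A ∪ D, A ∪ C] := by
  obtain ⟨hAB, -, -⟩ := isTight_mk_iff.1 hs
  obtain ⟨hCD, hKC, hKD⟩ := isTight_mk_iff.1 ht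
  have h3 : B ∩ C ≠ B ∩ D := by
    intro h3
    -- In this case `B ⊆ C ∩ D`, so that the smallest link is non-empty while another is empty.
    have hB : ∀ v ∈ B, v ∈ C ∩ D := fun v hv => (hCD.mem_or v).elim
      (fun h => ⟨h, (h3 ▸ ⟨hv, h⟩ : v ∈ B ∩ D).2⟩) (fun h => ⟨(h3 ▸ ⟨hv, h⟩ : v ∈ B ∩ C).2, h⟩)
    have h0 : (A ∩ B) \ D = ∅ := by
      ext v
      simp only [Set.mem_sdiff, Set.mem_empty_iff_false, iff_false, not_and, not_not]
      exact fun hv => (hB v hv.2).2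
    obtain ⟨v, hvB, hvA⟩ := hs.swap.sdiff_nonempty
    rw [h0, Set.ncard_empty, Nat.le_zero,
      Set.ncard_eq_zero (hY.subset Set.sdiff_subset)] at hc
    exact Set.eq_empty_iff_forall_notMem.1 hc v ⟨hB v hvB, hvA⟩
  refine ⟨isTStar_of_crosses hAB hCD hcr h3, hs, ?_⟩
  have hcen : ∀ v, v ∈ centre ![A, B ∩ C, B ∩ D] ![B, A ∪ D, A ∪ C] ↔ v ∈ A ∩ B ∩ (C ∩ D) := by
    intro v
    simp only [centre, Set.mem_iInter, Fin.forall_fin_succ]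
    simp only [Matrix.cons_val_zero, Matrix.cons_val_succ, IsEmpty.forall_iff, and_true,
      Set.mem_inter_iff, Set.mem_union]
    tauto
  have h01 : ∀ v ∈ (A ∩ B) \ D, v ∈ link ![A, B ∩ C, B ∩ D] ![B, A ∪ D, A ∪ C] 0 1 := fun v hv =>
    ⟨⟨hv.1, ⟨hv.1.2, (hCD.mem_or v).resolve_right hv.2⟩, .inl hv.1.1⟩,
      fun h => hv.2 ((hcen v).1 h).2.2⟩
  have h02 : ∀ v ∈ (A ∩ B) \ C, v ∈ link ![A, B ∩ C, B ∩ D] ![B, A ∪ D, A ∪ C] 0 2 := fun v hv =>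
    ⟨⟨hv.1, ⟨hv.1.2, (hCD.mem_or v).resolve_left hv.2⟩, .inl hv.1.1⟩,
      fun h => hv.2 ((hcen v).1 h).2.1⟩
  rintro x ⟨⟨⟨⟨hxB, hxC⟩, -⟩, ⟨⟨-, hxD⟩, -⟩⟩, hxZ⟩ i hi
  have hx : x ∈ (C ∩ D) \ A := ⟨⟨hxC, hxD⟩, fun hxA =>
    hxZ ((hcen x).2 ⟨⟨hxA, hxB⟩, hxC, hxD⟩)⟩
  have hne : ((C ∩ D) \ B).Nonempty := by
    rw [← Set.ncard_pos (hY.subset Set.sdiff_subset)]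
    exact lt_of_lt_of_le ((Set.ncard_pos (hY.subset Set.sdiff_subset)).2 ⟨x, hx⟩) ha
  fin_cases i
  · exact absurd rfl hi
  · rcases exists_adj_or_component hAB hCD hKC hne hx with ⟨y, hy, hxy⟩ | ⟨y, hy, K, hK⟩
    · exact .inl ⟨y, h01 y hy, hxy⟩
    · refine .inr ⟨y, ?_, K, hK⟩
      by_cases h : y ∈ D
      · exact .inr ((hcen y).2 ⟨hy.1, hy.2, h⟩)
      · exact .inl (h01 y ⟨hy.1, h⟩)
  · rw [Set.inter_comm C D] at hne hx hKD
    rcases exists_adj_or_component hAB hCD.symm hKD hne hx with ⟨y, hy, hxy⟩ | ⟨y, hy, K, hK⟩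
    · exact .inl ⟨y, h02 y hy, hxy⟩
    · refine .inr ⟨y, ?_, K, hK⟩
      by_cases h : y ∈ C
      · exact .inr ((hcen y).2 ⟨hy.1, h, hy.2⟩)
      · exact .inl (h02 y ⟨hy.1, h⟩)

theorem IsBottleneck.finite_inter {k : ℕ} {β : Set (Sym2 (Set V))} (hβ : IsBottleneck G k β)
    {A B : Set V} (hs : s(A, B) ∈ β) : (A ∩ B).Finite := by
  have := hβ.order_eq _ hs
  rw [order_mk] at this
  exact Set.finite_of_encard_eq_coe this

/-- A bottleneck containing `{A, B}` contains one of the two corners on the side of `B` if the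
link of these two corners is a smallest one. -/
theorem IsBottleneck.corner_mem {k : ℕ} {β : Set (Sym2 (Set V))} (hβ : IsBottleneck G k β)
    {A B C D : Set V} (hs : s(A, B) ∈ β) (ht : IsTight G s(C, D))
    (hcr : Crosses s(A, B) s(C, D)) (hY : (C ∩ D).Finite)
    (ha : ((C ∩ D) \ A).ncard ≤ ((C ∩ D) \ B).ncard)
    (hc : ((C ∩ D) \ A).ncard ≤ ((A ∩ B) \ D).ncard)
    (hd : ((C ∩ D) \ A).ncard ≤ ((A ∩ B) \ C).ncard) :
    corner B A C D ∈ β ∨ corner B A D C ∈ β := by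
  have hX := hβ.finite_inter hs
  have hst := hβ.tight _ hs
  have hAB := (isTight_mk_iff.1 hst).1
  have hCD := (isTight_mk_iff.1 ht).1
  have hk := hβ.order_eq _ hs
  refine hβ.another _ _ (isRelevant_of_crosses hst ht hcr hY ha hc) ?_ hs
  have hk' : (A ∩ B).ncard = k := by
    rw [order_mk, ← hX.cast_ncard_eq] at hk
    exact_mod_cast hk
  have hsep := ncard_separator hCD.1 hX
  have e1 := order_corner hAB.symm.1 hCD.1 (Set.inter_comm A B ▸ hX) hY
  have e2 := order_corner hAB.symm.1 hCD.symm.1 (Set.inter_comm A B ▸ hX) (Set.inter_comm C D ▸ hY)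
  rw [Set.inter_comm B A] at e1 e2
  rw [Set.inter_comm D C] at e2
  intro i
  fin_cases i
  · exact hk.le
  · refine (show order (corner B A C D) ≤ k from ?_)
    rw [e1]
    exact_mod_cast (by omega)
  · refine (show order (corner B A D C) ≤ k from ?_)
    rw [e2]
    exact_mod_cast (by omega)

/-! ### Nestedness of the chosen separations -/

/-- Crossing numbers are strictly submodular on opposite corners. -/
theorem ncard_crosses_corner_add_lt {U : Set (Sym2 (Set V))} {A B C D : Set V}
    (hsU : s(A, B) ∈ U) (hs : {r | r ∈ U ∧ Crosses s(A, B) r}.Finite)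
    (ht : {r | r ∈ U ∧ Crosses s(C, D) r}.Finite) (hcr : Crosses s(A, B) s(C, D)) :
    {r | r ∈ U ∧ Crosses (corner A B C D) r}.ncard +
      {r | r ∈ U ∧ Crosses (corner B A D C) r}.ncard <
      {r | r ∈ U ∧ Crosses s(A, B) r}.ncard + {r | r ∈ U ∧ Crosses s(C, D) r}.ncard := by
  set S := {r | r ∈ U ∧ Crosses s(A, B) r}
  set T := {r | r ∈ U ∧ Crosses s(C, D) r}
  set S' := {r | r ∈ U ∧ Crosses (corner A B C D) r} with hS'
  set T' := {r | r ∈ U ∧ Crosses (corner B A D C) r} with hT'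
  have hcr' : Crosses s(B, A) s(D, C) := hcr.swap_left.swap_right
  have hunion : ∀ r ∈ S' ∪ T', r ∈ S ∪ T := by
    intro r hr
    by_contra hST
    have hrU : r ∈ U := hr.elim (·.1) (·.1)
    simp only [Set.mem_union, not_or] at hST
    have h1 : Nested r s(A, B) := by_contra fun h => hST.1 ⟨hrU, fun h' => h h'.symm⟩
    have h2 : Nested r s(C, D) := by_contra fun h => hST.2 ⟨hrU, fun h' => h h'.symm⟩
    rcases hr with hr | hr
    · exact hr.2 (h1.corner h2 hcr).symm
    · rw [Sym2.eq_swap] at h1 h2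
      exact hr.2 (h1.corner h2 hcr').symm
  have hinter : S' ∩ T' ⊆ S ∩ T := by
    rintro r ⟨⟨hrU, h1⟩, ⟨-, h2⟩⟩
    refine ⟨⟨hrU, fun h => ?_⟩, ⟨hrU, fun h => ?_⟩⟩
    · exact (h.symm.corner_or C D).elim (fun h => h1 h.symm) (fun h => h2 h.symm)
    · rw [corner_comm] at h1 h2
      exact (h.symm.corner_or A B).elim (fun h => h1 h.symm) (fun h => h2 h.symm)
  have hfin := hs.union ht
  have hlt : S' ∪ T' ⊂ S ∪ T := by
    refine (Set.ssubset_iff_of_subset hunion).2 ⟨s(A, B), .inr ⟨hsU, hcr.symm⟩, ?_⟩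
    rintro (h | h)
    · exact h.2 (nested_corner_self A B C D).symm
    · refine h.2 ?_
      have := (nested_corner_self B A D C).symm
      rwa [Sym2.eq_swap (a := B)] at this
  have hS'fin := hfin.subset (Set.subset_union_left.trans hlt.subset)
  have hT'fin := hfin.subset (Set.subset_union_right.trans hlt.subset)
  have h1 := Set.ncard_lt_ncard hlt hfin
  have h2 := Set.ncard_le_ncard hinter (hs.subset Set.inter_subset_left)
  have h3 := Set.ncard_union_add_ncard_inter S T hs ht
  have h4 := Set.ncard_union_add_ncard_inter S' T' hS'fin hT'fin
  omega

theorem finite_crossedSeps (hfin : ∀ v, (G.neighborSet v).Finite) (hG : G.Connected) {k : ℕ}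
    {s : Sym2 (Set V)} (hs : s ∈ bottleneckSeps G k) : (crossedSeps G k s).Finite := by
  obtain ⟨β, hβ, hsβ⟩ := hs
  refine (finite_isTight_crosses hfin hG k (hβ.tight s hsβ)
    (by simp [hβ.order_eq s hsβ])).subset ?_
  rintro t ⟨⟨β', hβ', ht⟩, hcr⟩
  exact ⟨hβ'.tight t ht, (hβ'.order_eq t ht).le, hcr⟩

/-- If a corner has the same order as `{A, B}`, then the two links in which their separators differ
have the same size. -/
theorem ncard_link_eq_of_order_corner {A B C D : Set V} {k : ℕ} (hAB : IsSep G A B)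
    (hCD : IsSep G C D) (hX : (A ∩ B).Finite) (hY : (C ∩ D).Finite) (hk : order s(A, B) = k)
    (h : order (corner A B C D) = k) : ((C ∩ D) \ B).ncard = ((A ∩ B) \ C).ncard := by
  rw [order_corner hAB.1 hCD.1 hX hY, Nat.cast_inj] at h
  rw [order_mk, ← hX.cast_ncard_eq, Nat.cast_inj] at hk
  have := ncard_separator hCD.1 hX
  omega

/-- Two separations of the same order chosen from bottlenecks are nested: otherwise, the T-stars
of the two separations place enough corners in the two bottlenecks to contradict the
submodularity of the crossing numbers. -/
theorem nested_of_mem_minimalIn (hfin : ∀ v, (G.neighborSet v).Finite) (hG : G.Connected) {k : ℕ}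
    {M β β' : Set (Sym2 (Set V))} (hβ : IsBottleneck G k β) (hβ' : IsBottleneck G k β')
    {s t : Sym2 (Set V)} (hs : s ∈ minimalIn G k M β) (ht : t ∈ minimalIn G k M β') :
    Nested s t := by
  induction s using Sym2.ind with | _ A B =>
  induction t using Sym2.ind with | _ C D =>
  by_contra hcr
  change Crosses s(A, B) s(C, D) at hcr
  obtain ⟨⟨hsβ, hsM⟩, hsmin⟩ := hs
  obtain ⟨⟨htβ, htM⟩, htmin⟩ := ht
  have hX := hβ.finite_inter hsβ
  have hY := hβ'.finite_inter htβ
  have hsX : s(A, B) ∈ bottleneckSeps G k := ⟨β, hβ, hsβ⟩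
  have htX : s(C, D) ∈ bottleneckSeps G k := ⟨β', hβ', htβ⟩
  have hst := hβ.tight _ hsβ
  have htt := hβ'.tight _ htβ
  have hAB := (isTight_mk_iff.1 hst).1
  have hCD := (isTight_mk_iff.1 htt).1
  have hsf := finite_crossedSeps hfin hG hsX
  have htf := finite_crossedSeps hfin hG htX
  have e1 := ncard_crosses_corner_add_lt hsX hsf htf hcr
  have e2 := ncard_crosses_corner_add_lt hsX hsf (D := C) (C := D)
    (by rwa [Sym2.eq_swap (a := D)]) hcr.swap_right
  rw [Sym2.eq_swap (a := D)] at e2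
  have mono : ∀ (β : Set (Sym2 (Set V))) (s c : Sym2 (Set V)), IsBottleneck G k β → s ∈ β →
      (∀ t ∈ nestedWith M β, crossingNumber G k s ≤ crossingNumber G k t) → c ∈ β →
      (∀ r ∈ M, Nested c r) →
      {r | r ∈ bottleneckSeps G k ∧ Crosses s r}.ncard ≤
        {r | r ∈ bottleneckSeps G k ∧ Crosses c r}.ncard := by
    intro β s c hβ hs hmin hc hcM
    have h := hmin c ⟨hc, hcM⟩
    rw [crossingNumber, crossingNumber, ← (finite_crossedSeps hfin hG ⟨β, hβ, hs⟩).cast_ncard_eq,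
      ← (finite_crossedSeps hfin hG ⟨β, hβ, hc⟩).cast_ncard_eq] at h
    exact_mod_cast h
  have nest : ∀ A' B' C' D', s(A', B') = s(A, B) → s(C', D') = s(C, D) →
      ∀ r ∈ M, Nested (corner A' B' C' D') r := by
    intro A' B' C' D' h h' r hr
    refine (Nested.corner ?_ ?_ ?_).symm
    · exact h ▸ (hsM r hr).symm
    · exact h' ▸ (htM r hr).symm
    · exact h ▸ h' ▸ hcr
  have esw : s(B, A) = s(A, B) := Sym2.eq_swap
  have esw' : s(D, C) = s(C, D) := Sym2.eq_swap
  have hks := hβ.order_eq _ hsβ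
  have hkt := hβ'.order_eq _ htβ
  have hks' := hks
  have hkt' := hkt
  have hsw := hsβ
  have htw := htβ
  rw [← esw] at hks' hsw
  rw [← esw'] at hkt' htw
  have hXc := Set.inter_comm A B
  have hYc := Set.inter_comm C D
  have hX' := hXc ▸ hX
  have hY' := hYc ▸ hY
  -- the consequences of each corner lying in one of the two bottlenecks
  have sAC := fun h : corner A B C D ∈ β => And.intro
    (ncard_link_eq_of_order_corner hAB hCD hX hY hks (hβ.order_eq _ h))
    (mono β _ _ hβ hsβ hsmin h (nest _ _ _ _ rfl rfl))
  have sAD := fun h : corner A B D C ∈ β => And.intro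
    (ncard_link_eq_of_order_corner hAB hCD.symm hX hY' hks (hβ.order_eq _ h))
    (mono β _ _ hβ hsβ hsmin h (nest _ _ _ _ rfl esw'))
  have sBC := fun h : corner B A C D ∈ β => And.intro
    (ncard_link_eq_of_order_corner hAB.symm hCD hX' hY hks' (hβ.order_eq _ h))
    (mono β _ _ hβ hsβ hsmin h (nest _ _ _ _ esw rfl))
  have sBD := fun h : corner B A D C ∈ β => And.intro
    (ncard_link_eq_of_order_corner hAB.symm hCD.symm hX' hY' hks' (hβ.order_eq _ h))
    (mono β _ _ hβ hsβ hsmin h (nest _ _ _ _ esw esw'))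
  have tCA := fun h : corner C D A B ∈ β' => And.intro
    (ncard_link_eq_of_order_corner hCD hAB hY hX hkt (hβ'.order_eq _ h))
    (mono β' _ _ hβ' htβ htmin (corner_comm C D A B ▸ h) (nest _ _ _ _ rfl rfl))
  have tDA := fun h : corner D C A B ∈ β' => And.intro
    (ncard_link_eq_of_order_corner hCD.symm hAB hY' hX hkt' (hβ'.order_eq _ h))
    (mono β' _ _ hβ' htβ htmin (corner_comm D C A B ▸ h) (nest _ _ _ _ rfl esw'))
  have tCB := fun h : corner C D B A ∈ β' => And.intro
    (ncard_link_eq_of_order_corner hCD hAB.symm hY hX' hkt (hβ'.order_eq _ h))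
    (mono β' _ _ hβ' htβ htmin (corner_comm C D B A ▸ h) (nest _ _ _ _ esw rfl))
  have tDB := fun h : corner D C B A ∈ β' => And.intro
    (ncard_link_eq_of_order_corner hCD.symm hAB.symm hY' hX' hkt' (hβ'.order_eq _ h))
    (mono β' _ _ hβ' htβ htmin (corner_comm D C B A ▸ h) (nest _ _ _ _ esw esw'))
  have SB := fun h1 h2 h3 => (hβ.corner_mem hsβ htt hcr hY h1 h2 h3).imp sBC sBD
  have SA := fun h1 h2 h3 =>
    (hβ.corner_mem hsw htt hcr.swap_left hY h1 h2 h3).imp sAC sAD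
  have SD := fun h1 h2 h3 => (hβ'.corner_mem htβ hst hcr.symm hX h1 h2 h3).imp tDA tDB
  have SC := fun h1 h2 h3 =>
    (hβ'.corner_mem htw hst hcr.symm.swap_left hX h1 h2 h3).imp tCA tCB
  have n1 := ncard_separator hCD.1 hX
  have n2 := ncard_separator hAB.1 hY
  rw [order_mk, ← hX.cast_ncard_eq, Nat.cast_inj] at hks
  rw [order_mk, ← hY.cast_ncard_eq, Nat.cast_inj] at hkt
  rw [Set.inter_comm (C ∩ D)] at n2
  simp only [Set.inter_comm B A, Set.inter_comm D C] at *
  -- what remains is linear arithmetic in the sizes of the links and the four crossing numbers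
  clear mono nest sAC sAD sBC sBD tCA tDA tCB tDB hsmin htmin
  omega

theorem isTight_of_mem_NLevel {k : ℕ} {s : Sym2 (Set V)} (h : s ∈ NLevel G k) :
    IsTight G s ∧ order s = k := by
  obtain ⟨β, hβ, ⟨hs, -⟩, -⟩ := h
  exact ⟨hβ.tight s hs, hβ.order_eq s hs⟩

theorem nested_of_mem_NLevel (hfin : ∀ v, (G.neighborSet v).Finite) (hG : G.Connected) {i j : ℕ}
    {s t : Sym2 (Set V)} (hs : s ∈ NLevel G i) (ht : t ∈ NLevel G j) : Nested s t := by
  have key : ∀ i j s t, i < j → s ∈ NLevel G i → t ∈ NLevel G j → Nested t s := by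
    rintro i j s t hij hs ⟨β, hβ, ⟨-, ht⟩, -⟩
    refine ht s ?_
    rw [nBelow_eq]
    exact Set.mem_biUnion hij hs
  rcases lt_trichotomy i j with h | rfl | h
  · exact (key i j s t h hs ht).symm
  · obtain ⟨β, hβ, hs⟩ := hs
    obtain ⟨β', hβ', ht⟩ := ht
    exact nested_of_mem_minimalIn hfin hG hβ hβ' hs ht
  · exact key j i t s h ht hs

theorem isNestedSet_NUpTo (hfin : ∀ v, (G.neighborSet v).Finite) (hG : G.Connected) (k : ℕ) :
    IsNestedSet (NUpTo G k) := by
  intro s hs t ht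
  simp only [NUpTo, Set.mem_iUnion] at hs ht
  obtain ⟨i, -, hs⟩ := hs
  obtain ⟨j, -, ht⟩ := ht
  exact nested_of_mem_NLevel hfin hG hs ht

/-- A separation in a bottleneck that crosses some chosen separation of lower order can be replaced
by one of its corners: if neither of its two T-stars had order at most `k`, then the other
separation would have a T-star both of whose corners have order less than `j`, contrary to `β'`
being a bottleneck of order `j`. -/
theorem IsBottleneck.exists_corner_mem {j k : ℕ} (hjk : j < k) {β β' : Set (Sym2 (Set V))}
    (hβ : IsBottleneck G k β) (hβ' : IsBottleneck G j β') {A B C D : Set V} (hs : s(A, B) ∈ β)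
    (ht : s(C, D) ∈ β') (hcr : Crosses s(A, B) s(C, D)) :
    ∃ A' B' C' D', s(A', B') = s(A, B) ∧ s(C', D') = s(C, D) ∧ corner A' B' C' D' ∈ β := by
  have hX := hβ.finite_inter hs
  have hY := hβ'.finite_inter ht
  have hst := hβ.tight _ hs
  have htt := hβ'.tight _ ht
  have hAB := (isTight_mk_iff.1 hst).1
  have hCD := (isTight_mk_iff.1 htt).1
  have esw : s(B, A) = s(A, B) := Sym2.eq_swap
  have esw' : s(D, C) = s(C, D) := Sym2.eq_swap
  have hks := hβ.order_eq _ hs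
  have hkt := hβ'.order_eq _ ht
  have hkt' := hkt
  have hsw := hs
  have htw := ht
  rw [← esw] at hsw
  rw [← esw'] at hkt' htw
  have hXc := Set.inter_comm A B
  have hYc := Set.inter_comm C D
  have hX' := hXc ▸ hX
  have hY' := hYc ▸ hY
  by_contra! hno
  have sA := fun h : _ ∧ _ ∧ _ => (hβ.corner_mem hsw htt hcr.swap_left hY h.1 h.2.1 h.2.2).elim
    (hno _ _ _ _ rfl rfl) (hno _ _ _ _ rfl esw')
  have sB := fun h : _ ∧ _ ∧ _ => (hβ.corner_mem hs htt hcr hY h.1 h.2.1 h.2.2).elim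
    (hno _ _ _ _ esw rfl) (hno _ _ _ _ esw esw')
  have tCA := fun h => ncard_link_eq_of_order_corner hCD hAB hY hX hkt (hβ'.order_eq _ h)
  have tDA := fun h => ncard_link_eq_of_order_corner hCD.symm hAB hY' hX hkt' (hβ'.order_eq _ h)
  have tCB := fun h => ncard_link_eq_of_order_corner hCD hAB.symm hY hX' hkt (hβ'.order_eq _ h)
  have tDB := fun h =>
    ncard_link_eq_of_order_corner hCD.symm hAB.symm hY' hX' hkt' (hβ'.order_eq _ h)
  have tD := fun h1 h2 h3 => (hβ'.corner_mem ht hst hcr.symm hX h1 h2 h3).imp tDA tDB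
  have tC := fun h1 h2 h3 =>
    (hβ'.corner_mem htw hst hcr.symm.swap_left hX h1 h2 h3).imp tCA tCB
  have n1 := ncard_separator hCD.1 hX
  have n2 := ncard_separator hAB.1 hY
  rw [order_mk, ← hX.cast_ncard_eq, Nat.cast_inj] at hks
  rw [order_mk, ← hY.cast_ncard_eq, Nat.cast_inj] at hkt
  rw [Set.inter_comm (C ∩ D)] at n2
  simp only [Set.inter_comm B A, Set.inter_comm D C] at *
  clear hno tCA tDA tCB tDB
  rw [imp_false] at sA sB
  omega

/-- An element of `β` crossing as few chosen separations of lower order as possible crosses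
none of them, since a suitable corner would cross fewer. -/
theorem nestedWith_NBelow_nonempty (hfin : ∀ v, (G.neighborSet v).Finite) (hG : G.Connected)
    {k : ℕ} {β : Set (Sym2 (Set V))} (hβ : IsBottleneck G k β) :
    (nestedWith (NBelow G k) β).Nonempty := by
  have hmem : ∀ t ∈ NBelow G k, ∃ j < k, t ∈ NLevel G j := by
    intro t ht
    rw [nBelow_eq] at ht
    simpa using ht
  have hf : ∀ s ∈ β, {t | t ∈ NBelow G k ∧ Crosses s t}.Finite := by
    intro s hs
    refine (finite_isTight_crosses hfin hG k (hβ.tight s hs) (by simp [hβ.order_eq s hs])).subset ?_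
    rintro t ⟨ht, hcr⟩
    obtain ⟨j, hj, ht⟩ := hmem t ht
    obtain ⟨h1, h2⟩ := isTight_of_mem_NLevel ht
    exact ⟨h1, by rw [h2]; exact_mod_cast hj.le, hcr⟩
  obtain ⟨s, hs, hmin⟩ := WellFounded.has_min
    (measure fun s => {t | t ∈ NBelow G k ∧ Crosses s t}.ncard).wf β hβ.nonempty
  refine ⟨s, hs, fun t ht => by_contra fun hcr => ?_⟩
  obtain ⟨j, hj, β', hβ', htm⟩ := hmem t ht
  induction s using Sym2.ind with | _ A B =>
  induction t using Sym2.ind with | _ C D =>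
  obtain ⟨A', B', C', D', e, e', hc⟩ := hβ.exists_corner_mem hj hβ' hs htm.1.1 hcr
  refine hmin _ hc (Set.ncard_lt_ncard ?_ (hf _ hs))
  have hcr' : Crosses s(A', B') s(C', D') := e ▸ e' ▸ hcr
  have hN : ∀ r ∈ NBelow G k, Nested r s(C', D') := by
    intro r hr
    obtain ⟨i, -, hr⟩ := hmem r hr
    exact e' ▸ nested_of_mem_NLevel hfin hG hr ⟨β', hβ', htm⟩
  refine (Set.ssubset_iff_of_subset ?_).2 ⟨s(C, D), ⟨ht, hcr⟩, ?_⟩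
  · rintro r ⟨hr, hrc⟩
    refine ⟨hr, fun h => hrc ?_⟩
    exact (Nested.corner (e ▸ h.symm) (hN r hr) hcr').symm
  · rintro ⟨-, h⟩
    refine h ?_
    rw [corner_comm, ← e']
    exact (nested_corner_self C' D' A' B').symm

theorem minimalIn_NBelow_nonempty (hfin : ∀ v, (G.neighborSet v).Finite) (hG : G.Connected)
    {k : ℕ} {β : Set (Sym2 (Set V))} (hβ : IsBottleneck G k β) :
    (minimalIn G k (NBelow G k) β).Nonempty := by
  obtain ⟨s, hs, hmin⟩ := WellFounded.has_min (InvImage.wf (crossingNumber G k) wellFounded_lt) _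
    (nestedWith_NBelow_nonempty hfin hG hβ)
  exact ⟨s, hs, fun t ht => not_lt.1 (hmin t ht)⟩

theorem isTight_of_mem_NUpTo {k : ℕ} {s : Sym2 (Set V)} (h : s ∈ NUpTo G k) :
    IsTight G s ∧ order s ≤ k := by
  simp only [NUpTo, Set.mem_iUnion] at h
  obtain ⟨j, hj, h⟩ := h
  obtain ⟨h1, h2⟩ := isTight_of_mem_NLevel h
  exact ⟨h1, by rw [h2]; exact_mod_cast hj⟩

/-- Only finitely many oriented separations in `N` separate two given vertices, since their
separators meet a fixed path. -/
theorem finite_separating_NUpTo (hfin : ∀ v, (G.neighborSet v).Finite) (hG : G.Connected) (k : ℕ)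
    (u v : V) : {p : Set V × Set V | s(p.1, p.2) ∈ NUpTo G k ∧ u ∈ p.1 ∧ v ∈ p.2}.Finite := by
  obtain ⟨w⟩ := hG.preconnected u v
  have hU : (⋃ x ∈ {x | x ∈ w.support}, {s | IsTight G s ∧ order s ≤ k ∧ x ∈ separator s}).Finite :=
    (List.finite_toSet _).biUnion fun x _ => finite_isTight_of_mem_separator hfin hG k x
  refine (hU.preimage' (f := fun p : Set V × Set V => s(p.1, p.2)) fun s _ => ?_).subset ?_
  · induction s using Sym2.ind with | _ A B =>
    refine (Set.toFinite {(A, B), (B, A)}).subset ?_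
    rintro ⟨C, D⟩ h
    simpa using h
  · rintro ⟨A, B⟩ ⟨hN, hu, hv⟩
    obtain ⟨ht, ho⟩ := isTight_of_mem_NUpTo hN
    obtain ⟨x, hx, hxX⟩ := (isTight_mk_iff.1 ht).1.exists_mem_support w hu hv
    simp only [Set.mem_preimage, Set.mem_iUnion]
    exact ⟨x, hx, ht, ho, hxX⟩

/-! ### Orientations and splitting stars of a nested set -/

theorem SepGE.refl (p : Set V × Set V) : SepGE p p := ⟨subset_rfl, subset_rfl⟩

theorem SepGE.trans {p q r : Set V × Set V} (h : SepGE p q) (h' : SepGE q r) : SepGE p r :=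
  ⟨h.1.trans h'.1, h'.2.trans h.2⟩

theorem SepGE.antisymm {p q : Set V × Set V} (h : SepGE p q) (h' : SepGE q p) : p = q :=
  Prod.ext (h.1.antisymm h'.1) (h'.2.antisymm h.2)

theorem SepGE.swap {p q : Set V × Set V} (h : SepGE p q) : SepGE q.swap p.swap := ⟨h.2, h.1⟩

/-- The orientations of the elements of `N`. -/
def orientations (N : Set (Sym2 (Set V))) : Set (Set V × Set V) := {p | s(p.1, p.2) ∈ N}

/-- The oriented separations that point towards `σ`, that is, those with an element of `σ`
below them in the order `SepGE`. -/
def toward (σ : Set (Set V × Set V)) : Set (Set V × Set V) := {q | ∃ p ∈ σ, SepGE q p}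

theorem swap_mem_orientations {N : Set (Sym2 (Set V))} {p : Set V × Set V}
    (hp : p ∈ orientations N) : p.swap ∈ orientations N := by
  change s(p.2, p.1) ∈ N
  rwa [Sym2.eq_swap]

/-- A nested set of proper separations only finitely many of which separate any two given
vertices. -/
structure IsDiscreteTreeSet (G : SimpleGraph V) (N : Set (Sym2 (Set V))) : Prop where
  nested : IsNestedSet N
  proper : ∀ s ∈ N, IsProper G s
  finite : ∀ u v, {p : Set V × Set V | p ∈ orientations N ∧ u ∈ p.1 ∧ v ∈ p.2}.Finite

/-- A finite set of oriented separations has a minimal element below any given element `p₀`. -/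
theorem exists_minimal_sepGE {P : Set (Set V × Set V)} (hP : P.Finite) {p₀ : Set V × Set V}
    (hp₀ : p₀ ∈ P) : ∃ m ∈ P, SepGE p₀ m ∧ ∀ r ∈ P, SepGE m r → r = m := by
  let f : Set V × Set V → Set V × (Set V)ᵒᵈ := fun p => (p.1, OrderDual.toDual p.2)
  obtain ⟨_, h, ⟨⟨m, hm, rfl⟩, hmax⟩⟩ := (hP.image f).exists_le_maximal ⟨p₀, hp₀, rfl⟩
  refine ⟨m, hm, ⟨h.1, h.2⟩, fun r hr hmr => ?_⟩
  have := hmax ⟨r, hr, rfl⟩ (show f m ≤ f r from ⟨hmr.1, hmr.2⟩)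
  exact SepGE.antisymm ⟨this.1, this.2⟩ hmr

namespace IsDiscreteTreeSet

variable {N : Set (Sym2 (Set V))}

theorem isSep (hN : IsDiscreteTreeSet G N) {p : Set V × Set V} (hp : p ∈ orientations N) :
    IsSep G p.1 p.2 ∧ (p.1 \ p.2).Nonempty := by
  obtain ⟨A, B, hs, h, h1, h2⟩ := hN.proper _ hp
  rcases Sym2.eq_iff.1 hs with ⟨e, e'⟩ | ⟨e, e'⟩
  · rw [e, e']; exact ⟨h, h1⟩
  · rw [e, e']; exact ⟨h.symm, h2⟩

/-- An orientation of an element of `N` does not lie above both orientations of a separation, since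
its first side would be contained in its second side. -/
theorem not_sepGE_both (hN : IsDiscreteTreeSet G N)
    {p q : Set V × Set V} (hp : p ∈ orientations N) (h : SepGE p q)
    (h' : SepGE p q.swap) : False := by
  obtain ⟨v, hv, hv'⟩ := (hN.isSep hp).2
  exact hv' (h'.2 (h.1 hv))

theorem not_sepGE_both' (hN : IsDiscreteTreeSet G N)
    {p q : Set V × Set V} (hq : q ∈ orientations N) (h : SepGE p q)
    (h' : SepGE p.swap q) : False :=
  hN.not_sepGE_both (swap_mem_orientations hq) h.swap h'.swap

theorem finite_interval (hN : IsDiscreteTreeSet G N) {p q : Set V × Set V} (hp : p ∈ orientations N)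
    (hq : q ∈ orientations N) :
    {m | m ∈ orientations N ∧ SepGE p m ∧ SepGE m q}.Finite := by
  obtain ⟨u, hu, -⟩ := (hN.isSep hp).2
  obtain ⟨v, hv, -⟩ := (hN.isSep (swap_mem_orientations hq)).2
  exact (hN.finite u v).subset fun m hm => ⟨hm.1, hm.2.1.1 hu, hm.2.2.2 hv⟩

theorem exists_sepGE_or (hN : IsDiscreteTreeSet G N)
    {s : Sym2 (Set V)} (hs : s ∈ N) {p : Set V × Set V}
    (hp : p ∈ orientations N) :
    ∃ q : Set V × Set V, s = s(q.1, q.2) ∧ (SepGE q p ∨ SepGE q p.swap) := by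
  induction s using Sym2.ind with | _ A B =>
  rcases nested_mk_iff.1 (hN.nested _ hs _ hp) with h | h | h | h
  · exact ⟨(A, B), rfl, .inl h⟩
  · exact ⟨(A, B), rfl, .inr h⟩
  · exact ⟨(B, A), Sym2.eq_swap, .inl h⟩
  · exact ⟨(B, A), Sym2.eq_swap, .inr h⟩

/-- The set that consists of `p` and of the orientations of elements of `N` that are minimal among
those strictly above the inverse of `p`. It is the only splitting star that contains `p`. -/
def starAt (N : Set (Sym2 (Set V))) (p : Set V × Set V) : Set (Set V × Set V) :=
  {p} ∪ {q | (q ∈ orientations N ∧ q ≠ p.swap ∧ SepGE q p.swap) ∧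
    ∀ r ∈ orientations N, r ≠ p.swap → SepGE r p.swap → SepGE q r → r = q}

theorem isSplittingStar_starAt (hN : IsDiscreteTreeSet G N)
    {p : Set V × Set V} (hp : p ∈ orientations N) :
    IsSplittingStar N (starAt N p) := by
  have hpp : p.swap ≠ p := by
    intro h
    obtain ⟨v, hv, hv'⟩ := (hN.isSep hp).2
    exact hv' (h ▸ hv : v ∈ p.swap.1)
  refine ⟨?_, ?_, ?_, ?_⟩
  · rintro x (rfl | ⟨⟨hx, hxp, hxle⟩, hxmax⟩) y (rfl | ⟨⟨hy, hyp, hyle⟩, hymax⟩) hxy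
    · exact absurd rfl hxy
    · exact hyle.swap
    · exact hxle
    · obtain ⟨q, hq, h⟩ := hN.exists_sepGE_or hx hy
      rcases Sym2.eq_iff.1 hq with ⟨e, e'⟩ | ⟨e, e'⟩
      · obtain rfl : x = q := Prod.ext e e'
        rcases h with h | h
        · exact absurd (hxmax y hy hyp hyle h).symm hxy
        · exact h
      · obtain rfl : q = x.swap := Prod.ext e'.symm e.symm
        rcases h with h | h
        · exact absurd hxle fun h' =>
            hN.not_sepGE_both' (swap_mem_orientations hp) h' (h.trans hyle)
        · exact absurd (hymax x hx hxp hxle h.swap) hxy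
  · rintro x (rfl | ⟨⟨hx, -⟩, -⟩)
    · exact hp
    · exact hx
  · rintro x (rfl | ⟨⟨hx, hxp, hxle⟩, -⟩) (h | ⟨⟨-, h, h'⟩, -⟩)
    · exact hpp h
    · exact h rfl
    · exact hxp (by rw [← Prod.swap_swap x, h])
    · exact hN.not_sepGE_both' (swap_mem_orientations hp) hxle h'
  · intro s hs
    obtain ⟨q, rfl, h | h⟩ := hN.exists_sepGE_or hs hp
    · exact ⟨q, rfl, p, .inl rfl, h⟩
    by_cases hqp : q = p.swap
    · exact ⟨q.swap, Sym2.eq_swap, p, .inl rfl, by rw [hqp]; exact SepGE.refl p⟩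
    obtain ⟨m, ⟨hm, hmp⟩, hqm, hmax⟩ := exists_minimal_sepGE
      (P := {m | (m ∈ orientations N ∧ SepGE q m ∧ SepGE m p.swap) ∧ m ≠ p.swap})
      ((hN.finite_interval hs (swap_mem_orientations hp)).subset (Set.sep_subset _ _))
      ⟨⟨hs, SepGE.refl q, h⟩, hqp⟩
    exact ⟨q, rfl, m, .inr ⟨⟨hm.1, hmp, hm.2.2⟩, fun r hr hrp hrle hmr =>
      hmax r ⟨⟨hr, hqm.trans hmr, hrle⟩, hrp⟩ hmr⟩, hqm⟩

theorem mem_or_swap_mem_toward {σ : Set (Set V × Set V)} (hσ : IsSplittingStar N σ)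
    {q : Set V × Set V} (hq : q ∈ orientations N) : q ∈ toward σ ∨ q.swap ∈ toward σ := by
  obtain ⟨r, hr, p, hp, h⟩ := hσ.splits _ hq
  rcases Sym2.eq_iff.1 hr with ⟨e, e'⟩ | ⟨e, e'⟩
  · obtain rfl : q = r := Prod.ext e e'
    exact .inl ⟨p, hp, h⟩
  · obtain rfl : r = q.swap := Prod.ext e'.symm e.symm
    exact .inr ⟨p, hp, h⟩

theorem swap_notMem_toward (hN : IsDiscreteTreeSet G N)
    {σ : Set (Set V × Set V)} (hσ : IsSplittingStar N σ)
    {q : Set V × Set V} (hq : q ∈ toward σ) : q.swap ∉ toward σ := by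
  rintro ⟨p₂, hp₂, h₂⟩
  obtain ⟨p₁, hp₁, h₁⟩ := hq
  by_cases h : p₂ = p₁
  · subst h
    exact hN.not_sepGE_both' (hσ.mem _ hp₂) h₁ h₂
  · have : p₂ = p₁.swap := (hσ.star _ hp₂ _ hp₁ h).antisymm (h₁.swap.trans h₂)
    exact hσ.swap_notMem _ hp₁ (this ▸ hp₂)

/-- A splitting star is determined by any one of its elements. -/
theorem eq_starAt (hN : IsDiscreteTreeSet G N)
    {σ : Set (Set V × Set V)} (hσ : IsSplittingStar N σ) {p : Set V × Set V}
    (hpσ : p ∈ σ) : σ = starAt N p := by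
  -- what lies strictly above the inverse of `p` lies above an element of `σ` other than `p`
  have key : ∀ r ∈ orientations N, r ≠ p.swap → SepGE r p.swap →
      ∃ q ∈ σ, q ≠ p ∧ SepGE r q := by
    intro r hr hrp hrle
    rcases mem_or_swap_mem_toward hσ hr with ⟨q, hq, h⟩ | ⟨q, hq, h⟩
    · refine ⟨q, hq, ?_, h⟩
      rintro rfl
      exact hN.not_sepGE_both hr h hrle
    · exfalso
      by_cases hqp : q = p
      · subst hqp
        exact hrp (hrle.antisymm h.swap)
      · exact hN.not_sepGE_both' (swap_mem_orientations (hσ.mem p hpσ)) hrle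
          (h.trans (hσ.star _ hq _ hpσ hqp))
  ext q
  constructor
  · intro hq
    by_cases hqp : q = p
    · exact .inl hqp
    have hqs : q ≠ p.swap := fun h => hσ.swap_notMem _ hpσ (h ▸ hq)
    refine .inr ⟨⟨hσ.mem _ hq, hqs, hσ.star _ hq _ hpσ hqp⟩, fun r hr hrp hrle hqr => ?_⟩
    obtain ⟨q', hq', hq'p, h⟩ := key r hr hrp hrle
    by_cases hqq : q = q'
    · subst hqq
      exact h.antisymm hqr
    · exact absurd (hqr.trans h) fun h' =>
        hN.not_sepGE_both (hσ.mem _ hq) h' (hσ.star _ hq _ hq' hqq)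
  · rintro (rfl | ⟨⟨hq, hqp, hqle⟩, hmax⟩)
    · exact hpσ
    · obtain ⟨q', hq', hq'p, h⟩ := key q hq hqp hqle
      have := hmax q' (hσ.mem _ hq') (fun h => hσ.swap_notMem _ hpσ (h ▸ hq'))
        (hσ.star _ hq' _ hpσ hq'p) h
      exact this ▸ hq'

theorem exists_node (hN : IsDiscreteTreeSet G N)
    {p : Set V × Set V} (hp : p ∈ orientations N) : ∃ t : Node N, p ∈ t.1 :=
  ⟨⟨starAt N p, hN.isSplittingStar_starAt hp⟩, .inl rfl⟩

theorem node_unique (hN : IsDiscreteTreeSet G N)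
    {p : Set V × Set V} {t t' : Node N} (ht : p ∈ t.1) (ht' : p ∈ t'.1) :
    t = t' :=
  Subtype.ext ((hN.eq_starAt t.2 ht).trans (hN.eq_starAt t'.2 ht').symm)

theorem candidateWellDefined (hN : IsDiscreteTreeSet G N) : CandidateWellDefined N := by
  refine ⟨fun A B h => ?_, ?_⟩
  · obtain ⟨t, ht⟩ := hN.exists_node (p := (A, B)) h
    exact ⟨t, ht, fun t' ht' => hN.node_unique ht' ht⟩
  · rintro t₁ t₂ ⟨s, A, B, rfl, h₁, h₂⟩
    refine ⟨s(A, B), ⟨t₁.2.mem _ h₁, A, B, rfl, h₁, h₂⟩, ?_⟩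
    rintro _ ⟨-, C, D, rfl, h₁', h₂'⟩
    by_contra hne
    have hpq : (C, D) ≠ (A, B) := fun h => hne (by rw [Prod.mk.injEq] at h; rw [h.1, h.2])
    have hqp : (B, A) ≠ (D, C) := fun h => hpq (congrArg Prod.swap h).symm
    have h : (C, D) = (B, A) :=
      (t₁.2.star _ h₁' _ h₁ hpq).antisymm (t₂.2.star _ h₂ _ h₂' hqp)
    rw [h] at h₁'
    exact t₁.2.swap_notMem _ h₁ h₁'

/-! ### The decomposition tree -/

theorem exists_of_adj {t₁ t₂ : Node N} (h : (candidateTree N).Adj t₁ t₂) :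
    ∃ p ∈ t₁.1, p.swap ∈ t₂.1 := by
  obtain ⟨s, A, B, -, h₁, h₂⟩ := h
  exact ⟨(A, B), h₁, h₂⟩

theorem adj_of_mem {t₁ t₂ : Node N} {p : Set V × Set V} (h₁ : p ∈ t₁.1) (h₂ : p.swap ∈ t₂.1) :
    (candidateTree N).Adj t₁ t₂ := ⟨_, p.1, p.2, rfl, h₁, h₂⟩

/-- Adjacent nodes orient all elements of `N` alike, except the one that joins them. -/
theorem mem_toward_of_adj (hN : IsDiscreteTreeSet G N)
    {t₁ t₂ : Node N} {p q : Set V × Set V} (h₁ : p ∈ t₁.1)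
    (h₂ : p.swap ∈ t₂.1) (hq : q ∈ orientations N) (hqp : q ≠ p) (hqt : q ∈ toward t₁.1) :
    q ∈ toward t₂.1 := by
  obtain ⟨p', hp', h⟩ := hqt
  by_cases hpp : p' = p
  · subst hpp
    rcases mem_or_swap_mem_toward t₂.2 hq with h' | ⟨r, hr, h'⟩
    · exact h'
    · exfalso
      by_cases hrp : r = p'.swap
      · subst hrp
        exact hqp (h.antisymm h'.swap)
      · exact hN.not_sepGE_both' (t₁.2.mem _ hp') h (h'.trans (t₂.2.star _ hr _ h₂ hrp))
  · exact ⟨p.swap, h₂, h.trans (t₁.2.star _ hp' _ h₁ hpp)⟩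

/-- Deleting the edge given by `p` separates the nodes towards which `p` points from the others. -/
theorem mem_toward_of_reachable (hN : IsDiscreteTreeSet G N)
    {t₁ t₂ u w : Node N} {p : Set V × Set V} (h₁ : p ∈ t₁.1)
    (h₂ : p.swap ∈ t₂.1) (h : ((candidateTree N).deleteEdges {s(t₁, t₂)}).Reachable u w)
    (hu : p ∈ toward u.1) : p ∈ toward w.1 := by
  obtain ⟨w⟩ := h
  induction w with
  | nil => exact hu
  | cons hadj _ ih =>
    refine ih ?_
    rw [SimpleGraph.deleteEdges_adj] at hadj
    obtain ⟨q, hq, hq'⟩ := exists_of_adj hadj.1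
    refine hN.mem_toward_of_adj hq hq' (t₁.2.mem _ h₁) ?_ hu
    rintro rfl
    exact hadj.2 (by rw [hN.node_unique hq h₁, hN.node_unique hq' h₂]; rfl)

theorem mem_toward_self {σ : Set (Set V × Set V)} {p : Set V × Set V} (hp : p ∈ σ) :
    p ∈ toward σ := ⟨p, hp, SepGE.refl p⟩

/-- Distinct splitting stars are separated by an element of the first one. -/
theorem exists_swap_mem_toward_of_ne (hN : IsDiscreteTreeSet G N) {t t' : Node N} (h : t ≠ t') :
    ∃ p ∈ t.1, p.swap ∈ toward t'.1 := by
  by_contra! hno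
  have hsub : ∀ p ∈ t.1, p ∈ t'.1 := by
    intro p hp
    obtain ⟨p', hp', hpp'⟩ :=
      (mem_or_swap_mem_toward t'.2 (t.2.mem _ hp)).resolve_right (hno p hp)
    rcases mem_or_swap_mem_toward t.2 (t'.2.mem _ hp') with ⟨p₁, hp₁, h₁⟩ | ⟨p₁, hp₁, h₁⟩
    · by_cases hpp : p = p₁
      · subst hpp
        exact hpp'.antisymm h₁ ▸ hp'
      · exact (hN.not_sepGE_both (t.2.mem _ hp) (hpp'.trans h₁)
          (t.2.star _ hp _ hp₁ hpp)).elim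
    · obtain ⟨p₂, hp₂, h₂⟩ :=
        (mem_or_swap_mem_toward t'.2 (t.2.mem _ hp₁)).resolve_right (hno _ hp₁)
      exact (hN.swap_notMem_toward t'.2 (mem_toward_self hp') ⟨p₂, hp₂, h₁.trans h₂⟩).elim
  rcases t.1.eq_empty_or_nonempty with h0 | ⟨p, hp⟩
  · refine h (Subtype.ext ?_)
    rw [h0, eq_comm, Set.eq_empty_iff_forall_notMem]
    intro q hq
    obtain ⟨-, -, p, hp, -⟩ := t.2.splits _ (t'.2.mem _ hq)
    rw [h0] at hp
    exact hp
  · exact h (hN.node_unique hp (hsub p hp))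

/-- Any two nodes are joined by a path all whose parts contain the intersection of the two
parts: an element `p` of the first star that points away from the second node leads to a
neighbour, and this decreases the finite interval between the second node and `p`. -/
theorem reachable_induce (hN : IsDiscreteTreeSet G N)
    (U : Set V) (t t' : Node N) (ht : ∀ p ∈ t.1, U ⊆ p.2)
    (ht' : ∀ p ∈ t'.1, U ⊆ p.2) :
    ((candidateTree N).induce {t : Node N | ∀ p ∈ t.1, U ⊆ p.2}).Reachable ⟨t, ht⟩ ⟨t', ht'⟩ := by
  by_cases htt : t = t'
  · subst htt; rfl
  obtain ⟨p, hp, p', hp', hpp'⟩ := hN.exists_swap_mem_toward_of_ne htt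
  clear htt
  obtain ⟨n, hn⟩ : ∃ n, {m | m ∈ orientations N ∧ SepGE p'.swap m ∧ SepGE m p}.ncard < n :=
    ⟨_, Nat.lt_succ_self _⟩
  induction n generalizing t p with
  | zero => omega
  | succ n ih =>
    have hpN : p ∈ orientations N := t.2.mem _ hp
    obtain ⟨t₂, ht₂⟩ := hN.exists_node (swap_mem_orientations hpN)
    have hU : ∀ q ∈ t₂.1, U ⊆ q.2 := by
      intro q hq
      by_cases hqp : q = p.swap
      · subst hqp
        exact (ht' p' hp').trans hpp'.2
      · exact (ht p hp).trans (t₂.2.star _ hq _ ht₂ hqp).2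
    have hadj : ((candidateTree N).induce {t : Node N | ∀ p ∈ t.1, U ⊆ p.2}).Adj ⟨t, ht⟩ ⟨t₂, hU⟩ :=
      adj_of_mem hp ht₂
    refine hadj.reachable.trans ?_
    by_cases htt : t₂ = t'
    · subst htt; rfl
    obtain ⟨p₂, hp₂, p₂', hp₂', h₂⟩ := hN.exists_swap_mem_toward_of_ne htt
    have hne : p₂ ≠ p.swap := by
      rintro rfl
      exact hN.swap_notMem_toward t'.2 (q := p) ⟨p₂', hp₂', h₂⟩ ⟨p', hp', hpp'⟩
    have hle : SepGE p₂ p := t₂.2.star _ hp₂ _ ht₂ hne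
    have hne' : p₂ ≠ p := fun h => t₂.2.swap_notMem _ hp₂ (h ▸ ht₂)
    have heq : p₂' = p' := by
      by_contra hne''
      exact hN.not_sepGE_both (swap_mem_orientations hpN) hpp'
        ((hle.swap.trans h₂).trans (t'.2.star _ hp₂' _ hp' hne''))
    subst heq
    refine ih t₂ hU p₂ hp₂ h₂ ?_
    refine lt_of_lt_of_le (Set.ncard_lt_ncard ?_
      (hN.finite_interval (swap_mem_orientations (t'.2.mem _ hp')) hpN)) (Nat.lt_succ_iff.1 hn)
    refine (Set.ssubset_iff_of_subset ?_).2 ⟨p, ⟨hpN, hpp'.swap, SepGE.refl p⟩, ?_⟩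
    · exact fun m hm => ⟨hm.1, hm.2.1, hm.2.2.trans hle⟩
    · exact fun hm => hne' (hle.antisymm hm.2.2)

theorem reachable (hN : IsDiscreteTreeSet G N) (t t' : Node N) : (candidateTree N).Reachable t t' :=
  (hN.reachable_induce ∅ t t' (fun _ _ => Set.empty_subset _)
    (fun _ _ => Set.empty_subset _)).map (SimpleGraph.Embedding.induce _).toHom

theorem isAcyclic (hN : IsDiscreteTreeSet G N) : (candidateTree N).IsAcyclic := by
  rw [SimpleGraph.isAcyclic_iff_forall_adj_isBridge]
  intro t₁ t₂ hadj
  obtain ⟨p, h₁, h₂⟩ := exists_of_adj hadj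
  rw [SimpleGraph.isBridge_iff]
  intro h
  exact hN.swap_notMem_toward t₂.2 (hN.mem_toward_of_reachable h₁ h₂ h (mem_toward_self h₁))
    (mem_toward_self h₂)

/-- A non-empty set `U` that is separated by no element of `N` lies in some part. A minimal
orientation `p` below `p₀` with `U` on its second side, which exists since only finitely many
elements of `N` separate two given vertices, gives the node. -/
theorem exists_node_of_subset (hN : IsDiscreteTreeSet G N) {U : Set V} (hne : U.Nonempty)
    (hU : ∀ p ∈ orientations N, U ⊆ p.1 ∨ U ⊆ p.2) {p₀ : Set V × Set V}
    (hp₀ : p₀ ∈ orientations N) (hUp₀ : U ⊆ p₀.2) :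
    ∃ t : Node N, p₀ ∈ toward t.1 ∧ ∀ p ∈ t.1, U ⊆ p.2 := by
  obtain ⟨v, hv⟩ := hne
  obtain ⟨u, hu, -⟩ := (hN.isSep hp₀).2
  obtain ⟨p, ⟨hp, hpp, hUp⟩, -, hmax⟩ := exists_minimal_sepGE
    (P := {p | p ∈ orientations N ∧ SepGE p₀ p ∧ U ⊆ p.2})
    ((hN.finite u v).subset fun p h => ⟨h.1, h.2.1.1 hu, h.2.2 hv⟩) ⟨hp₀, SepGE.refl _, hUp₀⟩
  obtain ⟨t, ht⟩ := hN.exists_node hp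
  refine ⟨t, ⟨p, ht, hpp⟩, fun q hq => ?_⟩
  by_cases hqp : q = p
  · exact hqp ▸ hUp
  refine (hU q (t.2.mem _ hq)).resolve_left fun hUq => ?_
  have hpq := t.2.star _ ht _ hq (Ne.symm hqp)
  have := hmax q.swap ⟨swap_mem_orientations (t.2.mem _ hq), hpp.trans hpq, hUq⟩ hpq
  exact t.2.swap_notMem _ hq (this ▸ ht)

theorem exists_node_of_subset' (hN : IsDiscreteTreeSet G N) {U : Set V} (hne : U.Nonempty)
    (hU : ∀ p ∈ orientations N, U ⊆ p.1 ∨ U ⊆ p.2) : ∃ t : Node N, ∀ p ∈ t.1, U ⊆ p.2 := by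
  by_cases h : (orientations N).Nonempty
  · obtain ⟨p, hp⟩ := h
    rcases hU p hp with h | h
    · obtain ⟨t, -, ht⟩ := hN.exists_node_of_subset hne hU (swap_mem_orientations hp) h
      exact ⟨t, ht⟩
    · obtain ⟨t, -, ht⟩ := hN.exists_node_of_subset hne hU hp h
      exact ⟨t, ht⟩
  · refine ⟨⟨∅, by simp [IsStar], by simp, by simp, fun s hs => ?_⟩, by simp⟩
    induction s using Sym2.ind with | _ A B =>
    exact (h ⟨(A, B), hs⟩).elim

theorem singleton_subset_or (hN : IsDiscreteTreeSet G N)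
    (v : V) : ∀ p ∈ orientations N, {v} ⊆ p.1 ∨ {v} ⊆ p.2 := by
  intro p hp
  simpa using (hN.isSep hp).1.mem_or v

theorem mem_candidatePart {t : Node N} {v : V} :
    v ∈ (candidatePart G N t).verts ↔ ∀ p ∈ t.1, v ∈ p.2 := by
  simp [candidatePart]

theorem isTreeDecomposition (hN : IsDiscreteTreeSet G N) (hG : G.Connected) :
    IsTreeDecomposition G (candidateTree N) (candidatePart G N) := by
  have hex : ∀ v, ∃ t : Node N, ∀ p ∈ t.1, v ∈ p.2 := by
    intro v
    obtain ⟨t, ht⟩ := hN.exists_node_of_subset' (Set.singleton_nonempty v)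
      (hN.singleton_subset_or v)
    exact ⟨t, fun p hp => ht p hp rfl⟩
  refine ⟨⟨?_, hN.isAcyclic⟩, fun t => ?_, ?_, fun v => ?_⟩
  · obtain ⟨v⟩ := hG.nonempty
    obtain ⟨t, -⟩ := hex v
    have : Nonempty (Node N) := ⟨t⟩
    exact ⟨hN.reachable⟩
  · intro v hv w hw hvw
    exact ⟨hv, hw, hvw⟩
  · ext v w
    · simp only [SimpleGraph.Subgraph.verts_iSup, Set.mem_iUnion, SimpleGraph.Subgraph.verts_top,
        Set.mem_univ, iff_true]
      obtain ⟨t, ht⟩ := hex v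
      exact ⟨t, mem_candidatePart.2 ht⟩
    · simp only [SimpleGraph.Subgraph.iSup_adj, SimpleGraph.Subgraph.top_adj]
      refine ⟨fun ⟨t, ht⟩ => ht.adj_sub, fun hvw => ?_⟩
      obtain ⟨t, ht⟩ := hN.exists_node_of_subset' (U := {v, w}) (Set.insert_nonempty _ _) (by
        intro p hp
        have h := (hN.isSep hp).1
        simp only [Set.insert_subset_iff, Set.singleton_subset_iff]
        by_cases hv : v ∈ p.2
        · by_cases hw : w ∈ p.2
          · exact .inr ⟨hv, hw⟩
          · exact .inl ⟨h.mem_left hw hvw.symm, (h.mem_or w).resolve_right hw⟩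
        · exact .inl ⟨(h.mem_or v).resolve_right hv, h.mem_left hv hvw⟩)
      exact ⟨t, mem_candidatePart (G := G).2 fun p hp => ht p hp (by simp),
        mem_candidatePart (G := G).2 fun p hp => ht p hp (by simp), hvw⟩
  · obtain ⟨t, ht⟩ := hex v
    have key : {t | v ∈ (candidatePart G N t).verts} = {t : Node N | ∀ p ∈ t.1, {v} ⊆ p.2} := by
      ext t
      simp [mem_candidatePart]
    rw [key]
    have hne : Nonempty {t : Node N | ∀ p ∈ t.1, {v} ⊆ p.2} :=
      ⟨t, fun p hp => Set.singleton_subset_iff.2 (ht p hp)⟩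
    exact ⟨fun t t' => hN.reachable_induce {v} t.1 t'.1 t.2 t'.2⟩

/-- The edge given by `p = (A, B)` induces the separation `{A, B}`, with `B` on the side of the node
that contains `p`. -/
theorem inducedSide_eq (hN : IsDiscreteTreeSet G N)
    {t₁ t₂ : Node N} {p : Set V × Set V} (h₁ : p ∈ t₁.1)
    (h₂ : p.swap ∈ t₂.1) :
    inducedSide (candidateTree N) (candidatePart G N) t₁ t₂ = p.2 := by
  ext v
  constructor
  · rintro ⟨t, hr, hv⟩
    obtain ⟨q, hq, hpq⟩ := hN.mem_toward_of_reachable h₁ h₂ hr (mem_toward_self h₁)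
    exact hpq.2 (mem_candidatePart.1 hv q hq)
  · intro hv
    obtain ⟨t, hpt, ht⟩ := hN.exists_node_of_subset (Set.singleton_nonempty v)
      (hN.singleton_subset_or v) (t₁.2.mem _ h₁) (Set.singleton_subset_iff.2 hv)
    refine ⟨t, ?_, mem_candidatePart.2 fun q hq => ht q hq rfl⟩
    set T := (candidateTree N).deleteEdges {s(t₁, t₂)} with hT
    have hor : T.Reachable t₁ t ∨ T.Reachable t₂ t := by
      obtain ⟨w⟩ := hN.reachable t₁ t
      refine mem_of_walk (P := {t | T.Reachable t₁ t ∨ T.Reachable t₂ t}) w ?_ (.inl (.refl _))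
      intro x hx y _ hxy
      by_cases he : s(x, y) = s(t₁, t₂)
      · rcases Sym2.eq_iff.1 he with ⟨-, rfl⟩ | ⟨-, rfl⟩
        · exact .inr (.refl _)
        · exact .inl (.refl _)
      · have hadj : T.Adj x y := by
          rw [hT, SimpleGraph.deleteEdges_adj]
          exact ⟨hxy, he⟩
        exact hx.imp (·.trans hadj.reachable) (·.trans hadj.reachable)
    refine hor.resolve_right fun h => ?_
    rw [hT, Sym2.eq_swap] at h
    exact hN.swap_notMem_toward t.2 hpt
      (hN.mem_toward_of_reachable (p := p.swap) h₂ h₁ h (mem_toward_self h₂))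

theorem mem_inducedSeps (hN : IsDiscreteTreeSet G N) {s : Sym2 (Set V)} (hs : s ∈ N) :
    s ∈ inducedSeps (candidateTree N) (candidatePart G N) := by
  induction s using Sym2.ind with | _ A B =>
  obtain ⟨t₁, h₁⟩ := hN.exists_node (p := (B, A)) (swap_mem_orientations (p := (A, B)) hs)
  obtain ⟨t₂, h₂⟩ := hN.exists_node (p := (A, B)) hs
  refine ⟨t₁, t₂, adj_of_mem h₁ h₂, ?_⟩
  rw [hN.inducedSide_eq h₁ h₂, hN.inducedSide_eq h₂ h₁]

end IsDiscreteTreeSet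

/-! ### Tangles -/

theorem induce_sup_eq_top {P Q R : Set V} (hv : ∀ v, v ∈ P ∨ v ∈ Q ∨ v ∈ R)
    (he : ∀ u v, G.Adj u v → (u ∈ P ∧ v ∈ P) ∨ (u ∈ Q ∧ v ∈ Q) ∨ (u ∈ R ∧ v ∈ R)) :
    (⊤ : G.Subgraph).induce P ⊔ (⊤ : G.Subgraph).induce Q ⊔ (⊤ : G.Subgraph).induce R = ⊤ := by
  ext u v
  · simpa [or_assoc] using hv u
  · simp only [SimpleGraph.Subgraph.sup_adj, SimpleGraph.Subgraph.induce_adj,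
      SimpleGraph.Subgraph.top_adj]
    constructor
    · rintro ((h | h) | h) <;> exact h.2.2
    · intro h
      have := he u v h
      tauto

/-- Both ends of an edge lie on a common side of a separation. -/
theorem IsSep.adj_sides {A B : Set V} (h : IsSep G A B) {u v : V} (huv : G.Adj u v) :
    (u ∈ A ∧ v ∈ A) ∨ (u ∈ B ∧ v ∈ B) := by
  by_cases hu : u ∈ B
  · by_cases hv : v ∈ B
    · exact .inr ⟨hu, hv⟩
    · exact .inl ⟨h.mem_left hv huv.symm, (h.mem_or v).resolve_right hv⟩
  · exact .inl ⟨(h.mem_or u).resolve_right hu, h.mem_left hu huv⟩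

theorem isSep_union_compl {K X : Set V} (hX : nbhd G K ⊆ X) : IsSep G (K ∪ X) Kᶜ := by
  refine ⟨?_, ?_⟩
  · ext v
    by_cases hv : v ∈ K <;> simp [hv]
  · rintro a ⟨-, ha⟩ b ⟨hbK, hb⟩ hab
    exact hb (.inr (hX ⟨hbK, a, by simpa using ha, hab⟩))

namespace IsTangle

variable {m m' : ℕ∞} {τ τ' : Set (Set V × Set V)}

/-- The separation `(C, D)` lies in a tangle as soon as two sides `P`, `Q` of elements of the tangle
cover the graph together with `D`. -/
theorem mem_of_cover (hτ : IsTangle G m τ) {p q : Set V × Set V} (hp : p ∈ τ) (hq : q ∈ τ)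
    {C D : Set V} (h : IsSep G C D) (ho : order s(C, D) < m)
    (hv : ∀ v, v ∈ p.1 ∨ v ∈ q.1 ∨ v ∈ D)
    (he : ∀ u v, G.Adj u v → (u ∈ p.1 ∧ v ∈ p.1) ∨ (u ∈ q.1 ∧ v ∈ q.1) ∨ (u ∈ D ∧ v ∈ D)) :
    (C, D) ∈ τ :=
  (hτ.orients C D h ho).resolve_right fun h' =>
    hτ.not_cover p hp q hq (D, C) h' (induce_sup_eq_top hv he)

/-- Tangles are consistent. -/
theorem mem_of_subset (hτ : IsTangle G m τ) {A B C D : Set V} (hp : (A, B) ∈ τ)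
    (h : IsSep G C D) (ho : order s(C, D) < m) (hCA : C ⊆ A) : (C, D) ∈ τ :=
  hτ.mem_of_cover hp hp h ho
    (fun v => (h.mem_or v).elim (fun hv => .inl (hCA hv)) (fun hv => .inr (.inr hv)))
    (fun _ _ huv => (h.adj_sides huv).elim (fun h => .inl ⟨hCA h.1, hCA h.2⟩)
      (fun h => .inr (.inr h)))

theorem ne_univ (hτ : IsTangle G m τ) {A B : Set V} (hp : (A, B) ∈ τ) : A ≠ Set.univ := by
  rintro rfl
  exact hτ.not_cover _ hp _ hp _ hp (induce_sup_eq_top (by simp) (by simp))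

theorem ne (hτ : IsTangle G m τ) {A B : Set V} (hp : (A, B) ∈ τ) : A ≠ B := by
  rintro rfl
  refine hτ.ne_univ hp ?_
  simpa using (hτ.sep _ hp).1.1

/-- For a finite set `X` a tangle lives in a component of `G - X`, and the neighbourhood of that
component gives a separation in the tangle. -/
theorem exists_component (hfin : ∀ v, (G.neighborSet v).Finite) (hG : G.Connected)
    (hτ : IsTangle G m τ) {A B : Set V} (hp : (A, B) ∈ τ) (hX : (A ∩ B).Finite)
    (hne : (A ∩ B).Nonempty) :
    ∃ K, IsComponent G (A ∩ B)ᶜ K ∧ K ⊆ B ∧ (Kᶜ, K ∪ nbhd G K) ∈ τ := by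
  -- Among the elements of the tangle with separator `X` take one with largest small side; then
  -- what is left on its other side is a single component.
  obtain ⟨⟨A', B'⟩, ⟨⟨hsep, hX'⟩, hp', hAA'⟩, -, hmax⟩ := exists_minimal_sepGE
    (P := {p | (IsSep G p.1 p.2 ∧ p.1 ∩ p.2 = A ∩ B) ∧ p ∈ τ ∧ A ⊆ p.1})
    ((finite_isSep_of_inter_eq hfin hG hX hne).subset (Set.sep_subset _ _))
    (p₀ := (A, B)) ⟨⟨(hτ.sep _ hp).1, rfl⟩, hp, subset_rfl⟩
  have hordm : (A ∩ B).encard < m := (hτ.sep _ hp).2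
  dsimp only at hsep hX' hAA'
  obtain ⟨v, hvA'⟩ := (Set.ne_univ_iff_exists_notMem A').1 (hτ.ne_univ hp')
  have hvX : v ∈ (A ∩ B)ᶜ := fun h => hvA' (hX' ▸ h : v ∈ A' ∩ B').1
  obtain ⟨K, hK, hvK⟩ := exists_isComponent_mem (G := G) hvX
  have hKA' : ∀ u ∈ K, u ∉ A' := by
    intro u hu
    refine hK.subset_of_closed (P := A'ᶜ) ⟨v, hvK, hvA'⟩ (fun a ha haP b hb hab hbA' => ?_) hu
    exact hK.subset hb (hX' ▸ ⟨hbA', hsep.symm.mem_left haP hab⟩)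
  have hKB' : K ⊆ B' := fun u hu => (hsep.mem_or u).resolve_left (hKA' u hu)
  have hKB : K ⊆ B := fun u hu =>
    ((hτ.sep _ hp).1.mem_or u).resolve_left fun h => hKA' u hu (hAA' h)
  have hNX : nbhd G K ⊆ A ∩ B := by simpa using hK.nbhd_subset
  have hXK : ∀ u ∈ A ∩ B, u ∉ K := fun u hu huK => hK.subset huK hu
  -- moving `K` to the other side contradicts maximality
  have hsep' : IsSep G (A' ∪ K) (B' \ K) := by
    refine ⟨Set.eq_univ_of_forall fun u => ?_, ?_⟩
    · have := hsep.mem_or u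
      simp only [Set.mem_union, Set.mem_sdiff]
      tauto
    · rintro a ⟨ha, haB⟩ b ⟨hb, hbA⟩ hab
      simp only [Set.mem_union, not_or] at hbA
      by_cases haK : a ∈ K
      · exact hbA.1 (hX' ▸ hNX ⟨hb.2, a, haK, hab⟩ : b ∈ A' ∩ B').1
      · exact hsep.2 a ⟨ha.resolve_right haK, fun h => haB ⟨h, haK⟩⟩ b ⟨hb.1, hbA.1⟩ hab
  have hsepX : (A' ∪ K) ∩ (B' \ K) = A ∩ B := by
    ext u
    constructor
    · rintro ⟨h | h, h'⟩
      · exact hX' ▸ ⟨h, h'.1⟩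
      · exact (h'.2 h).elim
    · intro hu
      have hu' : u ∈ A' ∩ B' := hX'.symm ▸ hu
      exact ⟨.inl hu'.1, hu'.2, hXK u hu⟩
  have hmem : (B' \ K, A' ∪ K) ∈ τ := by
    refine (hτ.orients _ _ hsep' (by rwa [order_mk, hsepX])).resolve_left fun h => ?_
    have := hmax (A' ∪ K, B' \ K) ⟨⟨hsep', hsepX⟩, h, hAA'.trans Set.subset_union_left⟩
      ⟨Set.subset_union_left, Set.sdiff_subset⟩
    rw [Prod.mk.injEq] at this
    exact hvA' (this.1 ▸ Set.mem_union_right A' hvK)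
  have hKX : IsSep G Kᶜ (K ∪ (A ∩ B)) := (isSep_union_compl hNX).symm
  have hKXo : order s(Kᶜ, K ∪ (A ∩ B)) < m := by
    refine lt_of_le_of_lt (Set.encard_le_encard ?_) hordm
    rintro u ⟨hu, hu'⟩
    exact hu'.resolve_left hu
  have h1 : (Kᶜ, K ∪ (A ∩ B)) ∈ τ := by
    refine hτ.mem_of_cover hp' hmem hKX hKXo (fun u => ?_) (fun u w huw => ?_)
    · have := hsep.mem_or u
      simp only [Set.mem_sdiff, Set.mem_union]
      tauto
    · have hcase : ∀ u w, G.Adj u w → u ∈ K → w ∈ K ∪ (A ∩ B) := by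
        intro u w huw hu
        by_cases hw : w ∈ K
        · exact .inl hw
        · exact .inr (hNX ⟨hw, u, hu, huw⟩)
      by_cases hu : u ∈ K
      · exact .inr (.inr ⟨.inl hu, hcase u w huw hu⟩)
      by_cases hw : w ∈ K
      · exact .inr (.inr ⟨hcase w u huw.symm hw, .inl hw⟩)
      rcases hsep.adj_sides huw with h | h
      · exact .inl h
      · exact .inr (.inl ⟨⟨h.1, hu⟩, h.2, hw⟩)
  refine ⟨K, hK, hKB, hτ.mem_of_subset h1 (isSep_union_compl subset_rfl).symm ?_ subset_rfl⟩
  refine lt_of_le_of_lt (Set.encard_le_encard ?_) hKXo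
  exact Set.inter_subset_inter_right _ (Set.union_subset_union_right _ hNX)

/-- The full component of an efficient distinguisher in which the first tangle lives. If its
neighbourhood was smaller than the separator, it would give a distinguishing separation of smaller
order. -/
theorem exists_full_component (hfin : ∀ v, (G.neighborSet v).Finite) (hG : G.Connected)
    (hτ : IsTangle G m τ) (hτ' : IsTangle G m' τ') {A B : Set V} (hp : (A, B) ∈ τ)
    (hp' : (B, A) ∈ τ') (hX : (A ∩ B).Finite)
    (hmin : ∀ t, Distinguishes t τ τ' → order s(A, B) ≤ order t) :
    ∃ K, IsComponent G (A ∩ B)ᶜ K ∧ K ⊆ B ∧ nbhd G K = A ∩ B := by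
  have hAB := (hτ.sep _ hp).1
  have hne : (A ∩ B).Nonempty := by
    by_contra hX0
    rw [Set.not_nonempty_iff_eq_empty] at hX0
    have hnotB : ∀ v ∈ A, v ∉ B := fun v hA hB => by
      have : v ∈ A ∩ B := ⟨hA, hB⟩
      rwa [hX0] at this
    have hA0 : ¬ A.Nonempty := fun hA => hτ.ne_univ hp (eq_univ_of_closed hG hA
      fun a ha b hab => hAB.mem_left (hnotB a ha) hab)
    refine hτ'.ne_univ hp' ?_
    have := hAB.1
    rwa [Set.not_nonempty_iff_eq_empty.1 hA0, Set.empty_union] at this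
  obtain ⟨K, hK, hKB, hKτ⟩ := hτ.exists_component hfin hG hp hX hne
  have hNX : nbhd G K ⊆ A ∩ B := by simpa using hK.nbhd_subset
  have hK' : (K ∪ nbhd G K, Kᶜ) ∈ τ' := by
    refine hτ'.mem_of_subset hp' (isSep_union_compl subset_rfl) ?_
      (Set.union_subset hKB (hNX.trans Set.inter_subset_right))
    refine lt_of_le_of_lt (Set.encard_le_encard ?_) (hτ'.sep _ hp').2
    rintro u ⟨h | h, hu⟩
    · exact (hu h).elim
    · exact (hNX h).symm
  have hle := hmin s(Kᶜ, K ∪ nbhd G K) ⟨_, _, rfl, hτ.ne hKτ, hKτ, hK'⟩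
  refine ⟨K, hK, hKB, (hX.subset hNX).eq_of_subset_of_encard_le hNX
    (hle.trans (Set.encard_le_encard ?_))⟩
  rintro u ⟨hu, hu'⟩
  exact hu'.resolve_left hu

end IsTangle

theorem Distinguishes.symm {s : Sym2 (Set V)} {τ τ' : Set (Set V × Set V)}
    (h : Distinguishes s τ τ') : Distinguishes s τ' τ := by
  obtain ⟨A, B, rfl, hne, h, h'⟩ := h
  exact ⟨B, A, Sym2.eq_swap, hne.symm, h', h⟩

theorem EfficientlyDistinguishes.isTight (hfin : ∀ v, (G.neighborSet v).Finite)
    (hG : G.Connected) {m m' : ℕ∞} {τ τ' : Set (Set V × Set V)} (hτ : IsTangle G m τ)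
    (hτ' : IsTangle G m' τ') {s : Sym2 (Set V)} (hs : EfficientlyDistinguishes s τ τ')
    (ho : order s ≠ ⊤) : IsTight G s := by
  obtain ⟨⟨A, B, rfl, -, hp, hp'⟩, hmin⟩ := hs
  have hX : (A ∩ B).Finite := Set.encard_ne_top_iff.1 ho
  refine isTight_mk_iff.2 ⟨(hτ.sep _ hp).1, ?_,
    hτ.exists_full_component hfin hG hτ' hp hp' hX hmin⟩
  rw [Set.inter_comm] at hX ⊢
  refine hτ'.exists_full_component hfin hG hτ hp' hp hX fun t ht => ?_
  rw [Sym2.eq_swap]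
  exact hmin t ht.symm

theorem IsTStar.subset_of_ne {A B : Fin 3 → Set V} (h : IsTStar G A B) {i j : Fin 3}
    (hij : i ≠ j) : A i ⊆ B j := by
  intro v hv
  by_contra hvB
  have hvj : v ∈ A j \ B j := ⟨((h.sep j).mem_or v).resolve_right hvB, hvB⟩
  have hvi : v ∉ A i \ B i := Set.disjoint_right.1 (h.disjoint i j hij) hvj
  have hmem : v ∈ ⋃ i, A i \ B i := Set.mem_iUnion.2 ⟨j, hvj⟩
  rw [h.union] at hmem
  exact hmem (Set.mem_iUnion.2 ⟨i, hv, by_contra fun hB => hvi ⟨hv, hB⟩⟩)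

/-- The first sides of a T-star cover the graph. An edge whose ends both lie in separators is
covered since each end lies in two of the three separators. -/
theorem IsTStar.cover {A B : Fin 3 → Set V} (h : IsTStar G A B) :
    (⊤ : G.Subgraph).induce (A 0) ⊔ (⊤ : G.Subgraph).induce (A 1) ⊔
      (⊤ : G.Subgraph).induce (A 2) = ⊤ := by
  have hcase : ∀ v, (∃ i, v ∈ A i \ B i) ∨ ∃ i j, i ≠ j ∧ v ∈ A i ∧ v ∈ A j := by
    intro v
    by_cases hv : v ∈ ⋃ i, A i \ B i
    · exact .inl (Set.mem_iUnion.1 hv)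
    · rw [h.union, Set.mem_compl_iff, not_not] at hv
      obtain ⟨i, hi⟩ := Set.mem_iUnion.1 hv
      obtain ⟨j, hji, hj⟩ := h.covered i v hi
      exact .inr ⟨i, j, hji.symm, hi.1, hj.1⟩
  have hv : ∀ v, ∃ i, v ∈ A i := fun v =>
    (hcase v).elim (fun ⟨i, hi⟩ => ⟨i, hi.1⟩) (fun ⟨i, _, _, hi, _⟩ => ⟨i, hi⟩)
  have he : ∀ u v, G.Adj u v → ∃ i, u ∈ A i ∧ v ∈ A i := by
    intro u v huv
    rcases hcase u with ⟨i, hi⟩ | ⟨i, j, hij, hi, hj⟩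
    · exact ⟨i, hi.1, (h.sep i).mem_left hi.2 huv⟩
    rcases hcase v with ⟨i', hi'⟩ | ⟨i', j', hij', hi', hj'⟩
    · exact ⟨i', (h.sep i').mem_left hi'.2 huv.symm, hi'.1⟩
    have : i = i' ∨ i = j' ∨ j = i' ∨ j = j' := by omega
    rcases this with rfl | rfl | rfl | rfl
    · exact ⟨i, hi, hi'⟩
    · exact ⟨i, hi, hj'⟩
    · exact ⟨j, hj, hi'⟩
    · exact ⟨j, hj, hj'⟩
  refine induce_sup_eq_top (fun v => ?_) fun u v huv => ?_
  · simpa [Fin.exists_fin_succ] using hv v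
  · simpa [Fin.exists_fin_succ] using he u v huv

/-- If the base of a T-star efficiently distinguishes two tangles, then so does another constituent:
a tangle cannot contain all three elements of the T-star, since these cover the graph. -/
theorem IsTStar.exists_distinguishes {A B : Fin 3 → Set V} (h : IsTStar G A B) {m m' : ℕ∞}
    {τ τ' : Set (Set V × Set V)} (hτ : IsTangle G m τ) (hτ' : IsTangle G m' τ')
    (ho : ∀ i, order s(A i, B i) ≤ order s(A 0, B 0)) (hp : (A 0, B 0) ∈ τ)
    (hp' : (B 0, A 0) ∈ τ') :
    Distinguishes s(A 1, B 1) τ τ' ∨ Distinguishes s(A 2, B 2) τ τ' := by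
  have hm : ∀ i, order s(A i, B i) < m := fun i => (ho i).trans_lt (hτ.sep _ hp).2
  have hm' : ∀ i, order s(A i, B i) < m' := fun i => (ho i).trans_lt (by
    have := (hτ'.sep _ hp').2
    rwa [Sym2.eq_swap])
  have key : ∀ i, i ≠ 0 → (B i, A i) ∈ τ → Distinguishes s(A i, B i) τ τ' := fun i hi h' =>
    ⟨B i, A i, Sym2.eq_swap, hτ.ne h', h',
      hτ'.mem_of_subset hp' (h.sep i) (hm' i) (h.subset_of_ne hi)⟩
  rcases hτ.orients _ _ (h.sep 1) (hm 1) with h1 | h1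
  · rcases hτ.orients _ _ (h.sep 2) (hm 2) with h2 | h2
    · exact (hτ.not_cover _ hp _ h1 _ h2 h.cover).elim
    · exact .inr (key 2 (by simp) h2)
  · exact .inl (key 1 (by simp) h1)

/-- The efficient distinguishers of two tangles form a bottleneck. -/
theorem isBottleneck_efficientlyDistinguishes (hfin : ∀ v, (G.neighborSet v).Finite)
    (hG : G.Connected) {m m' : ℕ∞} {τ τ' : Set (Set V × Set V)} (hτ : IsTangle G m τ)
    (hτ' : IsTangle G m' τ') {s : Sym2 (Set V)} (hs : EfficientlyDistinguishes s τ τ') {j : ℕ}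
    (hj : order s = j) : IsBottleneck G j {s | EfficientlyDistinguishes s τ τ'} := by
  have ho : ∀ t, EfficientlyDistinguishes t τ τ' → order t = j := fun t ht =>
    hj ▸ (ht.2 s hs.1).antisymm (hs.2 t ht.1)
  refine ⟨⟨s, hs⟩, fun t ht => ht.isTight hfin hG hτ hτ' (by simp [ho t ht]), ho, ?_⟩
  intro A B hrel hAB hbase
  have hord := fun i => (hAB i).trans (ho _ hbase).ge
  have key : ∀ i, Distinguishes s(A i, B i) τ τ' → EfficientlyDistinguishes s(A i, B i) τ τ' :=
    fun i hi => ⟨hi, fun t ht => (hord i).trans (hbase.2 t ht)⟩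
  obtain ⟨⟨C, D, he, -, hC, hD⟩, -⟩ := hbase
  rcases Sym2.eq_iff.1 he with ⟨e, e'⟩ | ⟨e, e'⟩
  · subst e e'
    exact (hrel.1.exists_distinguishes hτ hτ' hord hC hD).imp (key 1) (key 2)
  · subst e e'
    exact (hrel.1.exists_distinguishes hτ' hτ hord hD hC).imp (fun h => key 1 h.symm)
      (fun h => key 2 h.symm)

/-- The level of the order at which two tangles are first distinguished contains an element of
the bottleneck of their efficient distinguishers. -/
theorem exists_efficientlyDistinguishes_mem_NUpTo (hfin : ∀ v, (G.neighborSet v).Finite)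
    (hG : G.Connected) {m m' : ℕ∞} {τ τ' : Set (Set V × Set V)} (hτ : IsTangle G m τ)
    (hτ' : IsTangle G m' τ') {k : ℕ} (hk : IsDistinguishable k τ τ') :
    ∃ s ∈ NUpTo G k, EfficientlyDistinguishes s τ τ' := by
  obtain ⟨s₀, hs₀, hs₀k⟩ := hk
  obtain ⟨s, hs, hmin⟩ := WellFounded.has_min (InvImage.wf order wellFounded_lt)
    {s : Sym2 (Set V) | Distinguishes s τ τ'} ⟨s₀, hs₀⟩
  have hmin' : ∀ t, Distinguishes t τ τ' → order s ≤ order t := fun t ht => not_lt.1 (hmin t ht)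
  have hsk := (hmin' s₀ hs₀).trans hs₀k
  obtain ⟨j, hj⟩ := ENat.ne_top_iff_exists.1 (ne_top_of_le_ne_top (ENat.natCast_ne_top k) hsk)
  have hβ := isBottleneck_efficientlyDistinguishes hfin hG hτ hτ' ⟨hs, hmin'⟩ hj.symm
  obtain ⟨t, ht⟩ := minimalIn_NBelow_nonempty hfin hG hβ
  refine ⟨t, ?_, ht.1.1⟩
  rw [← hj] at hsk
  exact Set.mem_biUnion (show j ≤ k by exact_mod_cast hsk) ⟨_, hβ, ht⟩

theorem isDiscreteTreeSet_NUpTo (hfin : ∀ v, (G.neighborSet v).Finite) (hG : G.Connected)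
    (k : ℕ) : IsDiscreteTreeSet G (NUpTo G k) where
  nested := isNestedSet_NUpTo hfin hG k
  proper _ hs := (isTight_of_mem_NUpTo hs).1.isProper
  finite := finite_separating_NUpTo hfin hG k

end TangleTree

theorem mainTheorem7 {V : Type*} (G : SimpleGraph V)
    (hfin : ∀ v, (G.neighborSet v).Finite) (hconn : G.Connected) (k : ℕ) :
    (∀ j ≤ k, ∀ s ∈ TangleTree.bottleneckSeps G j, (TangleTree.crossedSeps G j s).Finite) ∧
    TangleTree.IsNestedSet (TangleTree.NUpTo G k) ∧
    (∀ s ∈ TangleTree.NUpTo G k, TangleTree.IsProper G s) ∧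
    TangleTree.CandidateWellDefined (TangleTree.NUpTo G k) ∧
    TangleTree.IsTreeOfTangles G (TangleTree.candidateTree (TangleTree.NUpTo G k))
      (TangleTree.candidatePart G (TangleTree.NUpTo G k)) k := by
  have hN := TangleTree.isDiscreteTreeSet_NUpTo hfin hconn k
  refine ⟨fun j _ s hs => TangleTree.finite_crossedSeps hfin hconn hs, hN.nested, hN.proper,
    hN.candidateWellDefined, hN.isTreeDecomposition hconn, ?_⟩
  intro m m' τ τ' hτ hτ' hk
  obtain ⟨s, hs, he⟩ :=
    TangleTree.exists_efficientlyDistinguishes_mem_NUpTo hfin hconn hτ hτ' hk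
  exact ⟨s, hN.mem_inducedSeps hs, he⟩
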